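/- Let $(\mathcal S,\mathcal A,\mu)$ be a time-homogeneous MDP with finite state space $\mathcal S$, finite action space $\mathcal A$ and a finite set $\mathcal R\subset\mathbb R$ of rewards, where $\mu(\cdot\mid s,a)$ is the joint law of next state and reward. Let $\pi$ be a stationary policy, $s_0\in\mathcal S$ a starting state, $m\ge 1$ a horizon, and let $S_0=s_0$, $A_{t}\sim\pi(\cdot\mid S_{t-1})$, $(S_{t},R_{t})\sim\mu(\cdot\mid S_{t-1},A_{t})$ for $t\ge1$. Assume that the homogeneous Markov chain $(A_t,S_t)_{t\ge1}$, on the state space of those pairs that it visits with positive probability, is irreducible, essentially aperiodic (for each state the gcd of the possible return times is $1$, or there are none) and positive recurrent. Put $Y_t=(A_t,S_t,R_t)$ and $W_t=(Y_t,\dots,Y_{t+m})$. The state space $\mathcal Y$ of the chain $Y$ consists of the triples reachable in one step from a pair of the above state space, and the state space $\mathcal W$ of the chain $W$ consists of the $(y_0,\dots,y_m)\in\mathcal Y^{m+1}$ all of whose successive transitions have positive probability. Then the chain $W$ has a unique stationary distribution $\nu'$ on $\mathcal W$. Let $(A_0',S_0',R_0',\dots,A_m',S_m',R_m')\sim\nu'$,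 let $Z'=\sum_{i=1}^m R_i'$, let $\nu$ be the joint law of $Z'$ and these variables, and write $\nu(s\mid z,a)=\nu(S_0'=s\mid Z'=z,A_1'=a)$ and $\nu(z\mid a)=\nu(Z'=z\mid A'_1=a)$. Let $z_i=R_i+\dots+R_{i+m-1}$. For $n\ge 1$ let $s^{z,a}_{0:n-1}$ be the subsequence of $S_0,\dots,S_{n-1}$ formed by the $S_i$ with $z_{i+1}=z$ and $A_{i+1}=a$, and let $z^a_{1:n}$ be the subsequence of $z_1,\dots,z_n$ formed by the $z_i$ with $A_i=a$. Let $\rho(x\mid x_1\dots x_k)=\frac1k\#\{i\le k: x_i=x\}$ be the frequency estimator (with value $0$ if $k=0$). Then: 1. for all $s\in\mathcal S$, $z\in\mathbb R$ and $a\in\mathcal A$ with $\nu(Z'=z,A'_1=a)>0$, $\rho(s\mid s^{z,a}_{0:n-1})$ is a consistent estimator of $\nu(s\mid z,a)$, that is, it converges to it in probability as $n\to\infty$, and $f_n=|\rho(s\mid s^{z,a}_{0:n-1})-\nu(s\mid z,a)|$ converges stochastically to $0$ with rate $n^{-1/2}$; 2. for all $z\in\mathbb R$ and $a\in\mathcal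 A$ with $\nu(A'_1=a)>0$, $\rho(z\mid z^{a}_{1:n})$ is a consistent estimator of $\nu(z\mid a)$, and $f_n=|\rho(z\mid z^{a}_{1:n})-\nu(z\mid a)|$ converges stochastically to $0$ with rate $n^{-1/2}$. Here "$f_n$ converges stochastically to $0$ with rate $n^{-1/2}$" means that there is $c>0$ such that for all $n\ge1$ and all $\delta\in(0,1]$ $$\mathbb P\Big(|f_n|\le\sqrt{\tfrac cn\ln\tfrac2\delta}\Big)\ge 1-\delta .$$ -/

import Mathlib

open Filter Topology MeasureTheory

noncomputable section

namespace CNC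

/-! ### Homogeneous Markov chains on discrete state spaces -/

section Chains

variable {X : Type*}

/-- The `n`-step transition probabilities of the chain with one-step kernel `K`. -/
def iter (K : X → PMF X) : ℕ → X → PMF X
  | 0, x => PMF.pure x
  | n + 1, x => (iter K n x).bind K

/-- The states that the chain with initial law `init` visits with positive probability. -/
def reachable (init : PMF X) (K : X → PMF X) : Set X :=
  {x | ∃ n : ℕ, x ∈ (init.bind (iter K n)).support}

/-- (IR): every state of the state space `C` can be reached from every state of `C`. -/
def IsIrreducible (K : X → PMF X) (C : Set X) : Prop :=
  ∀ x ∈ C, ∀ y ∈ C, ∃ n : ℕ, 1 ≤ n ∧ iter K n x y ≠ 0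

/-- The possible return times `{n ≥ 1 : P[X_n = x | X_0 = x] > 0}`. -/
def returnTimes (K : X → PMF X) (x : X) : Set ℕ :=
  {n | 1 ≤ n ∧ iter K n x x ≠ 0}

/-- (EA): the gcd of the possible return times is `1` or `∞`, where `∞` is the gcd of the
empty set. -/
def IsEssentiallyAperiodic (K : X → PMF X) (C : Set X) : Prop :=
  ∀ x ∈ C, Nat.setGcd (returnTimes K x) = 1 ∨ returnTimes K x = ∅

open Classical in
/-- `firstHit K x n y` is the probability that the chain started at `y` visits `x` at time
`n + 1` and at none of the times `1, …, n`. -/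
def firstHit (K : X → PMF X) (x : X) : ℕ → X → ENNReal
  | 0, y => K y x
  | n + 1, y => ∑' y' : X, K y y' * (if y' = x then 0 else firstHit K x n y')

/-- The expected first return time `E[min {n ≥ 1 : X_n = x} | X_0 = x]`; the minimum is `∞` on
the event that `x` is not visited again. -/
def expectedReturnTime (K : X → PMF X) (x : X) : ENNReal :=
  (∑' n : ℕ, ((n : ENNReal) + 1) * firstHit K x n x) + ⊤ * (1 - ∑' n : ℕ, firstHit K x n x)

/-- (PR): all expected first return times are finite. -/
def IsPositiveRecurrent (K : X → PMF X) (C : Set X) : Prop :=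
  ∀ x ∈ C, expectedReturnTime K x < ⊤

/-- `p` is a stationary distribution, on the state space `C`, of the chain with kernel `K`. -/
def IsStationaryDist (K : X → PMF X) (C : Set X) (p : PMF X) : Prop :=
  p.support ⊆ C ∧ p.bind K = p

end Chains

/-! ### Markov decision processes -/

/-- A time-homogeneous MDP whose rewards are drawn from a finite set of reals: `kernel s a` is
the joint law of the next state and the reward after action `a` in state `s`. -/
structure MDP (S A : Type*) where
  /-- the set of possible rewards -/
  rewards : Finset ℝ
  /-- the transition probability kernel -/
  kernel : S → A → PMF (S × rewards)

namespace MDP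

variable {S A : Type*} (M : MDP S A) (pol : S → PMF A) (s₀ : S) (m : ℕ)

/-- The law of `(A_{t+1}, S_{t+1}, R_{t+1})` given `S_t = s`, under the stationary policy
`pol`. -/
def step (s : S) : PMF (A × S × M.rewards) :=
  (pol s).bind fun a => (M.kernel s a).map fun y => (a, y)

/-- The law of `X_{t+1} = (A_{t+1}, S_{t+1})` given `S_t = s`. -/
def pairStep (s : S) : PMF (A × S) :=
  (M.step pol s).map fun y => (y.1, y.2.1)

/-- The kernel of the chain `X_t = (A_t, S_t)`, `t ≥ 1`, defined by the MDP and the policy. -/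
def pairKernel (x : A × S) : PMF (A × S) := M.pairStep pol x.2

/-- The state space of the chain `X_t = (A_t, S_t)`, `t ≥ 1`: the pairs that occur with positive
probability when the system is started in `s₀`. -/
def pairSpace : Set (A × S) := reachable (M.pairStep pol s₀) (M.pairKernel pol)

/-- The MDP and the policy give rise to an (IR+EA+PR) chain. -/
structure IsIREAPR : Prop where
  irreducible : IsIrreducible (M.pairKernel pol) (M.pairSpace pol s₀)
  essentiallyAperiodic : IsEssentiallyAperiodic (M.pairKernel pol) (M.pairSpace pol s₀)
  positiveRecurrent : IsPositiveRecurrent (M.pairKernel pol) (M.pairSpace pol s₀)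

/-- The kernel of the chain `Y_t = (A_t, S_t, R_t)`. -/
def augKernel (y : A × S × M.rewards) : PMF (A × S × M.rewards) := M.step pol y.2.1

/-- The state space of the chain `Y_t = (A_t, S_t, R_t)`. -/
def augSpace : Set (A × S × M.rewards) :=
  {y | ∃ x ∈ M.pairSpace pol s₀, M.step pol x.2 y ≠ 0}

/-- Values `(y_0, …, y_m)` of `m + 1` consecutive triples. -/
abbrev Window : Type _ := Fin (m + 1) → A × S × M.rewards

/-- The kernel of the snake chain `W_t = (Y_t, …, Y_{t+m})`: drop the oldest triple and append a
new one. -/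
def snakeKernel (w : M.Window m) : PMF (M.Window m) :=
  (M.augKernel pol (w (Fin.last m))).map fun y =>
    Fin.snoc (α := fun _ => A × S × M.rewards) (Fin.tail w) y

/-- The state space of the snake chain. -/
def snakeSpace : Set (M.Window m) :=
  {w | (∀ i, w i ∈ M.augSpace pol s₀) ∧
    ∀ i : Fin m, M.augKernel pol (w i.castSucc) (w i.succ) ≠ 0}

/-- The return `Z' = R'_1 + ⋯ + R'_m` of a window. -/
def windowReturn (w : M.Window m) : ℝ := ∑ i : Fin m, ((w i.succ).2.2 : ℝ)

/-- The joint law `ν` of the return `Z'` and the window, when the window has law `ν'`. -/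
def joint (ν' : PMF (M.Window m)) : PMF (ℝ × M.Window m) :=
  ν'.map fun w => (M.windowReturn m w, w)

/-- The event `Z' = z`. -/
def returnEvent (z : ℝ) : Set (ℝ × M.Window m) := {q | q.1 = z}

/-- The event `S'_0 = s`. -/
def stateEvent (s : S) : Set (ℝ × M.Window m) := {q | (q.2 0).2.1 = s}

/-- The event `A'_1 = a` (for `m ≥ 1`). -/
def actionEvent (a : A) : Set (ℝ × M.Window m) := {q | (q.2 1).1 = a}

/-- An execution of the MDP under the policy from `s₀`: random variables `S_t` (`t ≥ 0`) and
`A_t`, `R_t` (`t ≥ 1`; the values at `t = 0` play no role) with `S_0 = s₀`,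
`A_{t+1} ∼ pol S_t` and `(S_{t+1}, R_{t+1}) ∼ kernel S_t A_{t+1}`, given through its
finite-dimensional distributions. -/
structure IsExecution {Ω : Type*} [MeasurableSpace Ω] (P : Measure Ω)
    (St : ℕ → Ω → S) (Ac : ℕ → Ω → A) (Re : ℕ → Ω → M.rewards) : Prop where
  measurable_state : ∀ t s, MeasurableSet {ω | St t ω = s}
  measurable_action : ∀ t a, MeasurableSet {ω | Ac t ω = a}
  measurable_reward : ∀ t r, MeasurableSet {ω | Re t ω = r}
  start : ∀ᵐ ω ∂P, St 0 ω = s₀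
  law : ∀ (n : ℕ) (s : ℕ → S) (a : ℕ → A) (r : ℕ → M.rewards), s 0 = s₀ →
    P {ω | ∀ t < n, Ac (t + 1) ω = a (t + 1) ∧ St (t + 1) ω = s (t + 1) ∧
        Re (t + 1) ω = r (t + 1)} =
      ∏ t ∈ Finset.range n,
        (pol (s t) (a (t + 1)) * M.kernel (s t) (a (t + 1)) (s (t + 1), r (t + 1)))

end MDP

/-- `P(E | F)` under `p`; meaningful if `F` has positive probability. -/
def condProb {X : Type*} (p : PMF X) (E F : Set X) : ℝ :=
  (p.toOuterMeasure (E ∩ F)).toReal / (p.toOuterMeasure F).toReal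

/-! ### Buckets and estimators -/

/-- The `m`-lagged return `z_i = r_i + ⋯ + r_{i+m-1}` of a reward sequence. -/
def laggedReturn (m : ℕ) (r : ℕ → ℝ) (i : ℕ) : ℝ := ∑ k ∈ Finset.range m, r (i + k)

open Classical in
/-- The subsequence `(s_i : z_{i+1} = z ∧ a_{i+1} = a)`, `i = 0, …, n - 1`. -/
def stateBucket {S A : Type*} (m : ℕ) (s : ℕ → S) (a : ℕ → A) (r : ℕ → ℝ) (z : ℝ) (b : A)
    (n : ℕ) : List S :=
  ((List.range n).filter fun i => laggedReturn m r (i + 1) = z ∧ a (i + 1) = b).map s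

open Classical in
/-- The subsequence `(z_i : a_i = a)`, `i = 1, …, n`. -/
def returnBucket {A : Type*} (m : ℕ) (a : ℕ → A) (r : ℕ → ℝ) (b : A) (n : ℕ) : List ℝ :=
  ((List.range n).filter fun i => a (i + 1) = b).map fun i => laggedReturn m r (i + 1)

open Classical in
/-- The frequency estimator `ρ(x | x_1 … x_k) = (1/k) #{i ≤ k : x_i = x}` (`0` if `k = 0`). -/
def freq {X : Type*} (past : List X) (x : X) : ℝ :=
  (past.count x : ℝ) / (past.length : ℝ)

/-- `est n` is a (weakly) consistent estimator of `θ`: it converges to `θ` in probability. -/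
def IsConsistent {Ω : Type*} [MeasurableSpace Ω] (P : Measure Ω) (est : ℕ → Ω → ℝ) (θ : ℝ) :
    Prop :=
  TendstoInMeasure P est atTop fun _ => θ

/-- `f n` converges stochastically to `0` with rate `n^{-1/2}`. At `δ = 0` the bound is infinite
and says nothing, so `δ` ranges over `(0, 1]`. -/
def HasStochasticRate {Ω : Type*} [MeasurableSpace Ω] (P : Measure Ω) (f : ℕ → Ω → ℝ) : Prop :=
  ∃ c : ℝ, 0 < c ∧ ∀ n : ℕ, 1 ≤ n → ∀ δ : ℝ, 0 < δ → δ ≤ 1 →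
    1 - δ ≤ P.real {ω | |f n ω| ≤ √(c / n * Real.log (2 / δ))}

end CNC

end

/-! The window chain moves by dropping its oldest triple and appending a new one. It inherits
closedness and irreducibility from the chain of pairs, and it lives on a finite set. Hence it has
exactly one stationary law `p`, and every `g` with `p`-mean zero is a coboundary `g = h - Kh` with
`K` the window kernel (Poisson equation, `exists_poisson`).

Along the windows `W_i` of a trajectory, the sum of `h(W_i) - Kh(W_i)` is a martingale with bounded
increments plus two bounded boundary terms. Hoeffding's lemma at each step
(`IsMarkov.integral_exp_le`) and Chernoff's bound (`IsMarkov.tail_bound`) show that the sum of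
`g(W_i)` over `i < n` exceeds `n ε` with probability at most `A exp(-n ε² / D)`.

A bucket frequency is a ratio of visit counts, visits to `E ∩ F` over visits to `F`. With `θ = p(E |
F)`, the functions `1_{E ∩ F} - θ 1_F` and `p(F) - 1_F` are centered: small sums of the first
control the numerator of the error, small sums of the second keep the denominator of order `n`
(`hasTail_ratio`). The resulting exponential tail yields both consistency and the rate `n^{-1/2}`.
-/

namespace CNC

/-! ### Finite stochastic matrices: Poisson equation and stationary vectors -/

section RealChains

variable {ι : Type*} [Fintype ι]

/-- The maximum principle: a harmonic function of an irreducible stochastic matrix is constant. -/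
theorem harmonic_const {Q : ι → ι → ℝ} (h0 : ∀ x y, 0 ≤ Q x y) (h1 : ∀ x, ∑ y, Q x y = 1)
    (hirr : ∀ x y, Relation.TransGen (fun x y => Q x y ≠ 0) x y)
    {h : ι → ℝ} (hh : ∀ x, h x = ∑ y, Q x y * h y) (x y : ι) : h x = h y := by
  obtain ⟨a, -, ha⟩ := Finset.exists_max_image Finset.univ h ⟨x, Finset.mem_univ x⟩
  -- At a maximum point the nonnegative gaps `h a - h w` have `Q`-average zero, so the maximum
  -- passes to every successor.
  have key : ∀ u v, h u = h a → Q u v ≠ 0 → h v = h a := by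
    intro u v hu huv
    have hs : ∑ w, Q u w * (h a - h w) = 0 := by
      simp only [mul_sub, Finset.sum_sub_distrib, ← Finset.sum_mul, h1]
      rw [← hh, hu]; ring
    have := (Finset.sum_eq_zero_iff_of_nonneg
      (fun w _ => mul_nonneg (h0 u w) (sub_nonneg.2 (ha w (Finset.mem_univ w))))).1 hs v
      (Finset.mem_univ v)
    rcases mul_eq_zero.1 this with h' | h'
    · exact absurd h' huv
    · linarith
  have all : ∀ v, h v = h a := by
    intro v
    induction hirr a v with
    | single hv => exact key _ _ rfl hv
    | tail _ hv ih => exact key _ _ ih hv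
  rw [all x, all y]

/-- Solvability of the Poisson equation of an irreducible stochastic matrix. -/
theorem exists_poisson_matrix {Q : ι → ι → ℝ} (h0 : ∀ x y, 0 ≤ Q x y)
    (h1 : ∀ x, ∑ y, Q x y = 1)
    (hirr : ∀ x y, Relation.TransGen (fun x y => Q x y ≠ 0) x y)
    {p : ι → ℝ} (hp1 : ∑ x, p x = 1) (hp : ∀ y, ∑ x, p x * Q x y = p y)
    {g : ι → ℝ} (hg : ∑ x, p x * g x = 0) :
    ∃ h : ι → ℝ, ∀ x, h x - ∑ y, Q x y * h y = g x := by
  -- The rank-one term `p·h` removes the constants from the kernel of `1 - Q`, so `T` is injective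
  -- and hence onto. Since `p·(T h) = p·h`, the extra term vanishes whenever the image is centered.
  let T : (ι → ℝ) →ₗ[ℝ] (ι → ℝ) :=
    { toFun := fun h x => h x - ∑ y, Q x y * h y + ∑ y, p y * h y
      map_add' := by
        intro f g; ext x
        simp only [Pi.add_apply, mul_add, Finset.sum_add_distrib]; ring
      map_smul' := by
        intro c f; ext x
        simp only [Pi.smul_apply, smul_eq_mul, RingHom.id_apply, mul_add, mul_sub, Finset.mul_sum,
          mul_left_comm] }
  have hT : ∀ h x, T h x = h x - ∑ y, Q x y * h y + ∑ y, p y * h y := fun _ _ => rfl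
  have hpT : ∀ h, ∑ x, p x * T h x = ∑ y, p y * h y := by
    intro h
    have : ∑ x, p x * ∑ y, Q x y * h y = ∑ y, p y * h y := by
      simp only [Finset.mul_sum]
      rw [Finset.sum_comm]
      refine Finset.sum_congr rfl fun y _ => ?_
      conv_rhs => rw [← hp y, Finset.sum_mul]
      exact Finset.sum_congr rfl fun x _ => by ring
    simp only [hT, mul_add, mul_sub, Finset.sum_add_distrib, Finset.sum_sub_distrib, this]
    rw [← Finset.sum_mul, hp1]; ring
  have hinj : Function.Injective T := by
    rw [← LinearMap.ker_eq_bot, LinearMap.ker_eq_bot']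
    intro h hh
    have hz : ∑ y, p y * h y = 0 := by rw [← hpT, hh]; simp
    have hharm : ∀ x, h x = ∑ y, Q x y * h y := by
      intro x
      have := congrFun hh x
      rw [hT, hz] at this
      simp only [Pi.zero_apply] at this; linarith
    ext x
    have hc : ∑ y, p y * h y = h x := by
      rw [Finset.sum_congr rfl fun y _ => by rw [harmonic_const h0 h1 hirr hharm y x],
        ← Finset.sum_mul, hp1, one_mul]
    rw [← hc, hz]; rfl
  obtain ⟨h, rfl⟩ := LinearMap.injective_iff_surjective.1 hinj g
  refine ⟨h, fun x => ?_⟩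
  rw [hpT] at hg
  rw [hT, hg, add_zero]

/-- A stochastic matrix has a stationary probability vector. -/
theorem exists_stationary_matrix [Nonempty ι] {Q : ι → ι → ℝ} (h0 : ∀ x y, 0 ≤ Q x y)
    (h1 : ∀ x, ∑ y, Q x y = 1) :
    ∃ p : ι → ℝ, (∀ x, 0 ≤ p x) ∧ ∑ x, p x = 1 ∧ ∀ y, ∑ x, p x * Q x y = p y := by
  classical
  -- `1 - Q` kills the constants, so it also has a nonzero left null vector, possibly of mixed sign.
  have hdet : (1 - Matrix.of Q : Matrix ι ι ℝ).det = 0 := by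
    refine Matrix.exists_mulVec_eq_zero_iff.1 ⟨fun _ => 1, ?_, ?_⟩
    · exact fun h => one_ne_zero (congrFun h (Classical.arbitrary ι))
    · ext x
      rw [Matrix.sub_mulVec, Matrix.one_mulVec]
      simp [Matrix.mulVec, dotProduct, h1]
  obtain ⟨p, hp0, hp⟩ := Matrix.exists_vecMul_eq_zero_iff.2 hdet
  have hp' : ∀ y, ∑ x, p x * Q x y = p y := by
    intro y
    have := congrFun hp y
    simp only [Matrix.vecMul_sub, Matrix.vecMul_one, Pi.sub_apply, Pi.zero_apply] at this
    rw [sub_eq_zero] at this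
    exact this.symm
  -- Both sides have the same total over `y`, so equality holds in each coordinate: `|p|` is
  -- stationary and only needs normalizing.
  have hle : ∀ y, |p y| ≤ ∑ x, |p x| * Q x y := by
    intro y
    rw [← hp' y]
    refine (Finset.abs_sum_le_sum_abs _ _).trans_eq (Finset.sum_congr rfl fun x _ => ?_)
    rw [abs_mul, abs_of_nonneg (h0 x y)]
  have hsum : ∑ y, |p y| = ∑ y, ∑ x, |p x| * Q x y := by
    rw [Finset.sum_comm]
    simp [← Finset.mul_sum, h1]
  have heq := (Finset.sum_eq_sum_iff_of_le (fun y _ => hle y)).1 hsum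
  have hpos : 0 < ∑ y, |p y| := by
    obtain ⟨x, hx⟩ := Function.ne_iff.1 hp0
    exact Finset.sum_pos' (fun _ _ => abs_nonneg _) ⟨x, Finset.mem_univ x, abs_pos.2 hx⟩
  refine ⟨fun x => |p x| / ∑ y, |p y|, fun x => by positivity, ?_, fun y => ?_⟩
  · rw [← Finset.sum_div, div_self hpos.ne']
  · simp only [div_mul_eq_mul_div]
    rw [← Finset.sum_div, ← heq y (Finset.mem_univ y)]

end RealChains

/-! ### Expectations on finite types and Hoeffding's lemma -/

section Avg

variable {X Y : Type*} [Fintype X] [Fintype Y]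

/-- The expectation of a real function under a distribution on a finite type. -/
noncomputable def avg (p : PMF X) (f : X → ℝ) : ℝ := ∑ x, (p x).toReal * f x

theorem sum_toReal (p : PMF X) : ∑ x, (p x).toReal = 1 := by
  rw [← ENNReal.toReal_sum fun x _ => p.apply_ne_top x, ← tsum_fintype (L := .unconditional X), p.tsum_coe,
    ENNReal.toReal_one]

theorem avg_const (p : PMF X) (c : ℝ) : avg p (fun _ => c) = c := by
  rw [avg, ← Finset.sum_mul, sum_toReal, one_mul]

theorem avg_sub (p : PMF X) (f g : X → ℝ) : avg p (fun x => f x - g x) = avg p f - avg p g := by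
  simp [avg, mul_sub]

theorem avg_add (p : PMF X) (f g : X → ℝ) : avg p (fun x => f x + g x) = avg p f + avg p g := by
  simp [avg, mul_add, Finset.sum_add_distrib]

theorem avg_neg (p : PMF X) (f : X → ℝ) : avg p (fun x => - f x) = - avg p f := by
  simp [avg]

theorem avg_mul_const (p : PMF X) (f : X → ℝ) (c : ℝ) :
    avg p (fun x => f x * c) = avg p f * c := by
  simp [avg, Finset.sum_mul, mul_assoc]

theorem avg_const_mul (p : PMF X) (f : X → ℝ) (c : ℝ) :
    avg p (fun x => c * f x) = c * avg p f := by
  simp only [avg, Finset.mul_sum, mul_left_comm]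

theorem avg_congr (p : PMF X) {f g : X → ℝ} (h : ∀ x, p x ≠ 0 → f x = g x) :
    avg p f = avg p g := by
  refine Finset.sum_congr rfl fun x _ => ?_
  by_cases hx : p x = 0
  · simp [hx]
  · rw [h x hx]

theorem avg_mono (p : PMF X) {f g : X → ℝ} (h : ∀ x, f x ≤ g x) : avg p f ≤ avg p g :=
  Finset.sum_le_sum fun x _ => mul_le_mul_of_nonneg_left (h x) ENNReal.toReal_nonneg

theorem abs_avg_le (p : PMF X) {f : X → ℝ} {c : ℝ} (h : ∀ x, |f x| ≤ c) : |avg p f| ≤ c := by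
  refine abs_le.2 ⟨?_, ?_⟩
  · rw [← avg_const p (-c)]; exact avg_mono p fun x => (abs_le.1 (h x)).1
  · rw [← avg_const p c]; exact avg_mono p fun x => (abs_le.1 (h x)).2

theorem avg_bind (p : PMF X) (K : X → PMF Y) (f : Y → ℝ) :
    avg (p.bind K) f = avg p fun x => avg (K x) f := by
  have : ∀ y, (p.bind K y).toReal = ∑ x, (p x).toReal * (K x y).toReal := by
    intro y
    rw [PMF.bind_apply, tsum_fintype, ENNReal.toReal_sum fun x _ =>
      ENNReal.mul_ne_top (p.apply_ne_top x) ((K x).apply_ne_top y)]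
    simp [ENNReal.toReal_mul]
  simp only [avg, this, Finset.sum_mul, Finset.mul_sum]
  rw [Finset.sum_comm]
  simp only [mul_assoc]

theorem avg_pure (x : X) (f : X → ℝ) : avg (PMF.pure x) f = f x := by
  classical
  rw [avg, Finset.sum_eq_single x]
  · simp
  · intro y _ hy; simp [PMF.pure_apply, hy]
  · simp

theorem avg_map (p : PMF X) (φ : X → Y) (f : Y → ℝ) :
    avg (p.map φ) f = avg p fun x => f (φ x) := by
  rw [← PMF.bind_pure_comp, avg_bind]
  simp [avg_pure]

open Classical in
theorem avg_indicator (p : PMF X) (E : Set X) :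
    avg p (fun x => if x ∈ E then 1 else 0) = (p.toOuterMeasure E).toReal := by
  rw [PMF.toOuterMeasure_apply_fintype, ENNReal.toReal_sum]
  · refine Finset.sum_congr rfl fun x _ => ?_
    by_cases hx : x ∈ E <;> simp [hx]
  · intro x _
    by_cases hx : x ∈ E <;> simp [hx, p.apply_ne_top x]

/-- Hoeffding's lemma on a finite space. -/
theorem avg_exp_le (p : PMF X) {f : X → ℝ} {D : ℝ} (hD : 0 < D) (hf : ∀ x, |f x| ≤ D)
    (h0 : avg p f = 0) (l : ℝ) :
    avg p (fun x => Real.exp (l * f x)) ≤ Real.exp (l ^ 2 * D ^ 2 / 2) := by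
  -- The right side is the chord of `exp` between `-l D` and `l D`; its linear part averages to
  -- zero, leaving `cosh (l D)`.
  have hb : ∀ x, Real.exp (l * f x) ≤ Real.cosh (l * D) + f x * (Real.sinh (l * D) / D) := by
    intro x
    obtain ⟨h1, h2⟩ := abs_le.1 (hf x)
    have h3 : -1 ≤ f x / D := by rw [le_div_iff₀ hD]; linarith
    have h4 : f x / D ≤ 1 := by rw [div_le_iff₀ hD]; linarith
    have hc := convexOn_exp.2 (Set.mem_univ (l * D)) (Set.mem_univ (-(l * D)))
      (show 0 ≤ (1 + f x / D) / 2 by linarith) (show 0 ≤ (1 - f x / D) / 2 by linarith) (by ring)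
    have e : ((1 + f x / D) / 2) • (l * D) + ((1 - f x / D) / 2) • (-(l * D)) = l * f x := by
      simp only [smul_eq_mul]; field_simp; ring
    rw [e] at hc
    refine hc.trans_eq ?_
    rw [Real.cosh_eq, Real.sinh_eq]
    simp only [smul_eq_mul]; field_simp; ring
  refine (avg_mono p hb).trans ?_
  rw [avg_add, avg_const, avg_mul_const, h0, zero_mul, add_zero]
  refine (Real.cosh_le_exp_half_sq _).trans_eq ?_
  congr 1; ring

end Avg

/-! ### Closed irreducible classes of finite chains -/

section FiniteChains

variable {X : Type*}

/-- The chain with kernel `K` can be in `y` one step after being in `x`. -/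
def Pos (K : X → PMF X) (x y : X) : Prop := K x y ≠ 0

variable {K : X → PMF X} {C : Set X}

/-- A path that starts in a closed set never leaves it. This lets the matrix results be used with
index type `C`, although the chain on all of `X` may be reducible. -/
theorem transGen_subtype (hC : ∀ x ∈ C, ∀ y, Pos K x y → y ∈ C) {x y : X} (hx : x ∈ C)
    (h : Relation.TransGen (Pos K) x y) :
    ∃ hy : y ∈ C, Relation.TransGen (fun u v : C => (K u v).toReal ≠ 0) ⟨x, hx⟩ ⟨y, hy⟩ := by
  have key : ∀ u v, Pos K u v → (K u v).toReal ≠ 0 := fun u v huv =>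
    (ENNReal.toReal_pos huv ((K u).apply_ne_top v)).ne'
  induction h with
  | single h => exact ⟨hC _ hx _ h, .single (key _ _ h)⟩
  | tail _ h ih =>
    obtain ⟨hy, ih⟩ := ih
    exact ⟨hC _ hy _ h, ih.tail (key _ _ h)⟩

variable [Fintype X]

theorem ext_of_avg {p q : PMF X} (h : ∀ f, avg p f = avg q f) : p = q := by
  classical
  ext x
  have := h fun y => if y = x then 1 else 0
  simp only [avg, mul_ite, mul_one, mul_zero, Finset.sum_ite_eq', Finset.mem_univ, if_true] at this
  exact (ENNReal.toReal_eq_toReal_iff' (p.apply_ne_top x) (q.apply_ne_top x)).1 this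

theorem sum_subtype_eq_avg [Fintype C] {p : PMF X} (h : ∀ y, p y ≠ 0 → y ∈ C) (f : X → ℝ) :
    ∑ y : C, (p y).toReal * f y = avg p f := by
  rw [avg, Finset.sum_set_coe (f := fun y => (p y).toReal * f y)]
  refine Finset.sum_subset (Finset.subset_univ _) fun y _ hy => ?_
  have : p y = 0 := by
    by_contra hn
    exact hy (Set.mem_toFinset.2 (h y hn))
  simp [this]

theorem exists_poisson (hC : ∀ x ∈ C, ∀ y, Pos K x y → y ∈ C)
    (hirr : ∀ x ∈ C, ∀ y ∈ C, Relation.TransGen (Pos K) x y) {p : PMF X}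
    (hp : IsStationaryDist K C p) {g : X → ℝ} (hg : avg p g = 0) :
    ∃ h : X → ℝ, ∀ x ∈ C, h x - avg (K x) h = g x := by
  classical
  have hpC : ∀ y, p y ≠ 0 → y ∈ C := fun y hy => hp.1 ((p.mem_support_iff y).2 hy)
  obtain ⟨h, hh⟩ := exists_poisson_matrix (ι := C) (Q := fun x y => (K x y).toReal)
    (p := fun x => (p x).toReal) (g := fun x => g x)
    (fun _ _ => ENNReal.toReal_nonneg)
    (fun x => by
      have := sum_subtype_eq_avg (hC x x.2) (fun _ => 1)
      simpa [avg_const] using this)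
    (fun x y => by
      obtain ⟨_, h⟩ := transGen_subtype hC x.2 (hirr x x.2 y y.2)
      exact h)
    (by
      have := sum_subtype_eq_avg hpC (fun _ => 1)
      simpa [avg_const] using this)
    (fun y => by
      have := sum_subtype_eq_avg hpC (fun x => (K x y).toReal)
      rw [this]
      conv_rhs => rw [← hp.2]
      rw [PMF.bind_apply, tsum_fintype, ENNReal.toReal_sum fun x _ =>
        ENNReal.mul_ne_top (p.apply_ne_top x) ((K x).apply_ne_top y)]
      simp [avg, ENNReal.toReal_mul])
    ((sum_subtype_eq_avg hpC g).trans hg)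
  -- The value outside `C` is immaterial, as one step from `C` stays in `C`.
  refine ⟨fun x => if hx : x ∈ C then h ⟨x, hx⟩ else 0, fun x hx => ?_⟩
  rw [← hh ⟨x, hx⟩, ← sum_subtype_eq_avg (hC x hx)]
  simp [hx]

theorem exists_stationary (hC : ∀ x ∈ C, ∀ y, Pos K x y → y ∈ C) (hne : C.Nonempty) :
    ∃ p, IsStationaryDist K C p := by
  classical
  have : Nonempty C := hne.to_subtype
  obtain ⟨p, hp0, hp1, hp⟩ := exists_stationary_matrix (ι := C) (Q := fun x y => (K x y).toReal)
    (fun _ _ => ENNReal.toReal_nonneg)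
    (fun x => by
      have := sum_subtype_eq_avg (hC x x.2) (fun _ => 1)
      simpa [avg_const] using this)
  let q : PMF C := PMF.ofFintype (fun x => ENNReal.ofReal (p x)) (by
    rw [← ENNReal.ofReal_sum_of_nonneg fun x _ => hp0 x, hp1, ENNReal.ofReal_one])
  have hq : ∀ f, avg q f = ∑ x, p x * f x := fun f =>
    Finset.sum_congr rfl fun x _ => by
      rw [PMF.ofFintype_apply, ENNReal.toReal_ofReal (hp0 x)]
  refine ⟨q.map Subtype.val, ?_, ext_of_avg fun f => ?_⟩
  · intro x hx
    rw [PMF.support_map] at hx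
    obtain ⟨y, -, rfl⟩ := hx
    exact y.2
  · rw [avg_bind, avg_map, avg_map, hq, hq]
    have hpf : ∀ y : C, p y * f y = ∑ x : C, p x * (K x y).toReal * f y := fun y => by
      rw [← Finset.sum_mul, hp]
    rw [Finset.sum_congr rfl fun y _ => hpf y, Finset.sum_comm]
    refine Finset.sum_congr rfl fun x _ => ?_
    rw [← sum_subtype_eq_avg (hC x x.2), Finset.mul_sum]
    exact Finset.sum_congr rfl fun y _ => by ring

/-- Solve `h - Kh = f - avg p f` and integrate against `q`: stationarity of `q` kills the left side,
so `avg q f = avg p f`. -/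
theorem stationary_unique (hC : ∀ x ∈ C, ∀ y, Pos K x y → y ∈ C)
    (hirr : ∀ x ∈ C, ∀ y ∈ C, Relation.TransGen (Pos K) x y) {p q : PMF X}
    (hp : IsStationaryDist K C p) (hq : IsStationaryDist K C q) : p = q := by
  refine ext_of_avg fun f => ?_
  obtain ⟨h, hh⟩ := exists_poisson hC hirr hp (g := fun x => f x - avg p f)
    (by rw [avg_sub, avg_const, sub_self])
  have h1 : avg q (fun x => h x - avg (K x) h) = avg q fun x => f x - avg p f :=
    avg_congr q fun x hx => hh x (hq.1 ((q.mem_support_iff x).2 hx))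
  rw [avg_sub, avg_sub, avg_const, ← avg_bind, hq.2] at h1
  linarith

end FiniteChains

/-! ### Markov processes, their windows and exponential moments -/

section Trajectories

variable {X Ω : Type*}

/-- The window `(Z_i, …, Z_{i+m})`. -/
def win (m : ℕ) (Z : ℕ → Ω → X) (i : ℕ) (ω : Ω) : Fin (m + 1) → X := fun j => Z (i + j) ω

/-- The values of a process up to time `N`. -/
def hist (Z : ℕ → Ω → X) (N : ℕ) (ω : Ω) : Fin (N + 1) → X := fun j => Z j ω

/-- `f` is determined by the values of `Z` up to time `N`. -/
def Adapted {β : Type*} (Z : ℕ → Ω → X) (N : ℕ) (f : Ω → β) : Prop :=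
  ∀ ω ω', (∀ t ≤ N, Z t ω = Z t ω') → f ω = f ω'

/-- For finite `X` there are finitely many histories, so integrals of adapted functions become
finite sums, with no need for conditional expectations. -/
theorem Adapted.exists_eq {β : Type*} [Nonempty β] {Z : ℕ → Ω → X} {N : ℕ} {f : Ω → β}
    (hf : Adapted Z N f) : ∃ F : (Fin (N + 1) → X) → β, ∀ ω, f ω = F (hist Z N ω) := by
  classical
  have h : Function.FactorsThrough f (hist Z N) := fun ω ω' hh =>
    hf ω ω' fun t ht => congrFun hh ⟨t, Nat.lt_succ_of_le ht⟩
  exact ⟨Function.extend (hist Z N) f fun _ => Classical.arbitrary β, fun ω =>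
    (h.extend_apply _ ω).symm⟩

theorem win_succ (m : ℕ) (Z : ℕ → Ω → X) (i : ℕ) (ω : Ω) :
    win m Z (i + 1) ω = Fin.snoc (α := fun _ => X) (Fin.tail (win m Z i ω)) (Z (i + m + 1) ω) := by
  ext j
  refine Fin.lastCases ?_ (fun j => ?_) j
  · simp only [Fin.snoc_last, win, Fin.val_last]; congr 1; omega
  · simp only [Fin.snoc_castSucc, win, Fin.tail, Fin.val_castSucc, Fin.val_succ]; congr 1; omega

variable [MeasurableSpace Ω] {P : Measure Ω}

/-- A process with the finite-dimensional distributions of the Markov chain with initial law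
`init` and kernel `K`. -/
structure IsMarkov (P : Measure Ω) (init : PMF X) (K : X → PMF X) (Z : ℕ → Ω → X) : Prop where
  measurable : ∀ t x, MeasurableSet {ω | Z t ω = x}
  law : ∀ (N : ℕ) (z : ℕ → X), P {ω | ∀ t ≤ N, Z t ω = z t} =
    init (z 0) * ∏ t ∈ Finset.range N, K (z t) (z (t + 1))

/-- The kernel of the chain of windows `(y_t, …, y_{t+m})` of a chain with kernel `K`. -/
noncomputable def snake (K : X → PMF X) (m : ℕ) (w : Fin (m + 1) → X) : PMF (Fin (m + 1) → X) :=
  (K (w (Fin.last m))).map fun y => Fin.snoc (α := fun _ => X) (Fin.tail w) y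

theorem integral_finite [IsFiniteMeasure P] {T : Type*} [Fintype T] {V : Ω → T}
    (hV : ∀ v, MeasurableSet {ω | V ω = v}) (F : T → ℝ) :
    Integrable (fun ω => F (V ω)) P ∧ ∫ ω, F (V ω) ∂P = ∑ v, P.real {ω | V ω = v} * F v := by
  let _ : MeasurableSpace T := ⊤
  have hm : Measurable V := measurable_to_countable' hV
  have hF : Integrable F (P.map V) := Integrable.of_finite
  refine ⟨hF.comp_measurable hm, ?_⟩
  rw [← integral_map hm.aemeasurable hF.aestronglyMeasurable, integral_fintype hF]
  refine Finset.sum_congr rfl fun v _ => ?_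
  rw [map_measureReal_apply hm trivial, smul_eq_mul]
  rfl

variable {K : X → PMF X} {init : PMF X} {Z : ℕ → Ω → X}

theorem IsMarkov.measurableSet_hist (hZ : IsMarkov P init K Z) (N : ℕ) (v : Fin (N + 1) → X) :
    MeasurableSet {ω | hist Z N ω = v} := by
  have : {ω | hist Z N ω = v} = ⋂ i : Fin (N + 1), {ω | Z i ω = v i} := by
    ext ω; simp [funext_iff, hist]
  rw [this]
  exact MeasurableSet.iInter fun i : Fin (N + 1) => hZ.measurable i (v i)

theorem IsMarkov.law_hist (hZ : IsMarkov P init K Z) (N : ℕ) (z : ℕ → X) :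
    P {ω | hist Z N ω = fun i : Fin (N + 1) => z i} =
      init (z 0) * ∏ t ∈ Finset.range N, K (z t) (z (t + 1)) := by
  rw [← hZ.law]
  congr 1; ext ω
  simp only [Set.mem_ofPred_eq, funext_iff, hist]
  exact ⟨fun h t ht => h ⟨t, Nat.lt_succ_of_le ht⟩, fun h i => h i (Nat.le_of_lt_succ i.2)⟩

theorem IsMarkov.law_succ (hZ : IsMarkov P init K Z) (N : ℕ) (v : Fin (N + 1) → X) (x : X) :
    P {ω | (hist Z N ω, Z (N + 1) ω) = (v, x)} =
      P {ω | hist Z N ω = v} * K (v (Fin.last N)) x := by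
  let z : ℕ → X := fun t => if h : t < N + 1 then v ⟨t, h⟩ else x
  have hv : v = fun i : Fin (N + 1) => z i := by
    ext i; exact (show z i = v i from dif_pos i.2).symm
  have hlast : v (Fin.last N) = z N := by simp [z, Fin.last]
  have hx : x = z (N + 1) := by simp [z]
  have : {ω | (hist Z N ω, Z (N + 1) ω) = (v, x)} =
      {ω | hist Z (N + 1) ω = fun i : Fin (N + 1 + 1) => z i} := by
    ext ω
    simp only [Set.mem_ofPred_eq, Prod.mk.injEq]
    rw [hx, hv]
    simp only [funext_iff, hist]
    constructor
    · rintro ⟨h1, h2⟩ i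
      rcases Nat.lt_succ_iff_lt_or_eq.1 i.2 with h | h
      · exact h1 ⟨i, h⟩
      · rw [h]; exact h2
    · intro h
      exact ⟨fun i => h i.castSucc, h (Fin.last _)⟩
  rw [this, hZ.law_hist, hlast, hx]
  conv_rhs => rw [hv, hZ.law_hist]
  rw [Finset.prod_range_succ, mul_assoc]

variable [Fintype X]

theorem IsMarkov.integrable [IsFiniteMeasure P] (hZ : IsMarkov P init K Z) {N : ℕ} {f : Ω → ℝ}
    (hf : Adapted Z N f) : Integrable f P := by
  obtain ⟨F, hF⟩ := hf.exists_eq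
  rw [funext hF]
  exact (integral_finite (hZ.measurableSet_hist N) F).1

/-- The Markov property. -/
theorem IsMarkov.integral_succ [IsFiniteMeasure P] (hZ : IsMarkov P init K Z) {N : ℕ}
    {G : Ω → X → ℝ} (hG : Adapted Z N G) :
    ∫ ω, G ω (Z (N + 1) ω) ∂P = ∫ ω, avg (K (Z N ω)) (G ω) ∂P := by
  obtain ⟨F, hF⟩ := hG.exists_eq
  have hm : ∀ vx : (Fin (N + 1) → X) × X,
      MeasurableSet {ω | (hist Z N ω, Z (N + 1) ω) = vx} := by
    rintro ⟨v, x⟩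
    simp only [Prod.mk.injEq]
    exact (hZ.measurableSet_hist N v).inter (hZ.measurable (N + 1) x)
  have h1 := (integral_finite (P := P) hm fun vx => F vx.1 vx.2).2
  have h2 := (integral_finite (P := P) (hZ.measurableSet_hist N)
    fun v => avg (K (v (Fin.last N))) (F v)).2
  simp only [hF]
  refine h1.trans (Eq.trans ?_ h2.symm)
  rw [Fintype.sum_prod_type]
  refine Finset.sum_congr rfl fun v _ => ?_
  rw [avg, Finset.mul_sum]
  refine Finset.sum_congr rfl fun x _ => ?_
  rw [Measure.real, hZ.law_succ, ENNReal.toReal_mul, mul_assoc]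
  rfl

/-- Almost surely, all transitions of a Markov chain have positive probability. -/
theorem IsMarkov.ae_pos (hZ : IsMarkov P init K Z) :
    ∀ᵐ ω ∂P, init (Z 0 ω) ≠ 0 ∧ ∀ t, Pos K (Z t ω) (Z (t + 1) ω) := by
  -- There are finitely many histories of a given length, so those of probability zero together form
  -- a null set.
  have key : ∀ N, ∀ᵐ ω ∂P, P {ω' | hist Z N ω' = hist Z N ω} ≠ 0 := by
    intro N
    rw [ae_iff]
    refine measure_mono_null (t := ⋃ v ∈ {v | P {ω | hist Z N ω = v} = 0},
      {ω | hist Z N ω = v}) ?_ ?_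
    · intro ω hω
      simp only [not_not, Set.mem_ofPred_eq, ne_eq] at hω
      simp only [Set.mem_iUnion, Set.mem_ofPred_eq]
      exact ⟨_, hω, rfl⟩
    · exact (measure_biUnion_null_iff (Set.to_countable _)).2 fun v hv => hv
  filter_upwards [ae_all_iff.2 key] with ω hω
  have h : ∀ N, init (Z 0 ω) ≠ 0 ∧
      ∏ t ∈ Finset.range N, K (Z t ω) (Z (t + 1) ω) ≠ 0 := fun N => by
    have : init (Z 0 ω) * ∏ t ∈ Finset.range N, K (Z t ω) (Z (t + 1) ω) ≠ 0 := fun h0 =>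
      hω N ((hZ.law_hist N fun t => Z t ω).trans h0)
    exact ⟨left_ne_zero_of_mul this, right_ne_zero_of_mul this⟩
  exact ⟨(h 0).1, fun t => Finset.prod_ne_zero_iff.1 (h (t + 1)).2 t (Finset.self_mem_range_succ t)⟩

theorem avg_snake {m : ℕ} (w : Fin (m + 1) → X) (f : (Fin (m + 1) → X) → ℝ) :
    avg (snake K m w) f = avg (K (w (Fin.last m))) fun y =>
      f (Fin.snoc (α := fun _ => X) (Fin.tail w) y) :=
  avg_map _ _ _

/-- The exponential moments of the additive functional of a coboundary. -/
theorem IsMarkov.integral_exp_le [IsProbabilityMeasure P] (hZ : IsMarkov P init K Z) {m : ℕ}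
    {h : (Fin (m + 1) → X) → ℝ} {H : ℝ} (hH : 0 < H) (hh : ∀ w, |h w| ≤ H) (l : ℝ) (n : ℕ) :
    ∫ ω, Real.exp (l * ∑ i ∈ Finset.range n,
      (h (win m Z i ω) - avg (snake K m (win m Z i ω)) h)) ∂P ≤
      Real.exp (2 * |l| * H + n * (2 * l ^ 2 * H ^ 2)) := by
  set g : (Fin (m + 1) → X) → ℝ := fun w => h w - avg (snake K m w) h with hg
  have hwin : ∀ n, Adapted Z (n + m) (win m Z n) := fun n ω ω' hω => by
    ext j; exact hω _ (by omega)
  have hsum : ∀ n k, n ≤ k + 1 → Adapted Z (k + m) fun ω => ∑ i ∈ Finset.range n, g (win m Z i ω) :=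
    fun n k hn ω ω' hω => Finset.sum_congr rfl fun i hi => by
      rw [hwin i ω ω' fun t ht => hω t (by have := Finset.mem_range.1 hi; omega)]
  have hstep : ∀ w, Real.exp (l * g w) * avg (snake K m w) (fun w' => Real.exp (l * h w')) ≤
      Real.exp (2 * l ^ 2 * H ^ 2) * Real.exp (l * h w) := by
    intro w
    have hav := abs_avg_le (snake K m w) hh
    have := avg_exp_le (snake K m w) (f := fun w' => h w' - avg (snake K m w) h)
      (D := 2 * H) (by positivity)
      (fun w' => (abs_sub _ _).trans (by linarith [hh w']))
      (by rw [avg_sub, avg_const, sub_self]) l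
    calc _ = Real.exp (l * h w) *
        avg (snake K m w) (fun w' => Real.exp (l * (h w' - avg (snake K m w) h))) := by
          rw [← avg_const_mul, ← avg_const_mul]
          congr 1; ext w'
          rw [← Real.exp_add, ← Real.exp_add]; congr 1; simp only [hg]; ring
      _ ≤ Real.exp (l * h w) * Real.exp (l ^ 2 * (2 * H) ^ 2 / 2) :=
          mul_le_mul_of_nonneg_left this (Real.exp_pos _).le
      _ = _ := by rw [mul_comm]; congr 2; ring
  -- The factor `exp (l * h)` at the current window closes the induction: by `hstep`, one Markov
  -- step multiplies the bound by at most `exp (2 l² H²)`.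
  have hmain : ∀ n : ℕ, ∫ ω, Real.exp (l * ∑ i ∈ Finset.range n, g (win m Z i ω)) *
      Real.exp (l * h (win m Z n ω)) ∂P ≤ Real.exp (|l| * H + n * (2 * l ^ 2 * H ^ 2)) := by
    intro n
    induction n with
    | zero =>
      have : ∀ ω, Real.exp (l * h (win m Z 0 ω)) ≤ Real.exp (|l| * H) := fun ω =>
        Real.exp_le_exp.2 ((le_abs_self _).trans (by
          rw [abs_mul]; exact mul_le_mul_of_nonneg_left (hh _) (abs_nonneg l)))
      simp only [Finset.range_zero, Finset.sum_empty, mul_zero, Real.exp_zero, one_mul,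
        Nat.cast_zero, zero_mul, add_zero]
      refine (integral_mono (hZ.integrable (N := 0 + m) fun ω ω' hω => ?_)
        (integrable_const _) this).trans_eq (by simp)
      rw [hwin 0 ω ω' hω]
    | succ n ih =>
      have h1 := hZ.integral_succ (N := n + m)
        (G := fun ω x => Real.exp (l * ∑ i ∈ Finset.range (n + 1), g (win m Z i ω)) *
          Real.exp (l * h (Fin.snoc (α := fun _ => X) (Fin.tail (win m Z n ω)) x)))
        (fun ω ω' hω => by
          have e1 := hsum (n + 1) n le_rfl ω ω' hω
          have e2 := hwin n ω ω' hω
          simp only at e1 ⊢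
          rw [e1, e2])
      simp only [← win_succ] at h1
      rw [h1]
      have h2 : ∀ ω, avg (K (Z (n + m) ω)) (fun x =>
          Real.exp (l * ∑ i ∈ Finset.range (n + 1), g (win m Z i ω)) *
          Real.exp (l * h (Fin.snoc (α := fun _ => X) (Fin.tail (win m Z n ω)) x))) ≤
          Real.exp (2 * l ^ 2 * H ^ 2) * (Real.exp (l * ∑ i ∈ Finset.range n, g (win m Z i ω)) *
            Real.exp (l * h (win m Z n ω))) := by
        intro ω
        have e : avg (K (Z (n + m) ω)) (fun x =>
            Real.exp (l * h (Fin.snoc (α := fun _ => X) (Fin.tail (win m Z n ω)) x))) =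
            avg (snake K m (win m Z n ω)) (fun w' => Real.exp (l * h w')) := by
          rw [avg_snake]; rfl
        rw [avg_const_mul, e, Finset.sum_range_succ, mul_add, Real.exp_add, mul_assoc,
          mul_left_comm (Real.exp (2 * l ^ 2 * H ^ 2))]
        exact mul_le_mul_of_nonneg_left (hstep _) (Real.exp_pos _).le
      refine (integral_mono (hZ.integrable (N := n + m) fun ω ω' hω => ?_)
        ((hZ.integrable (N := n + m) fun ω ω' hω => ?_).const_mul _) h2).trans ?_
      · have e1 := hsum (n + 1) n le_rfl ω ω' hω
        have e2 := hwin n ω ω' hω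
        simp only at e1
        rw [e1, e2, hω (n + m) le_rfl]
      · have e1 := hsum n n (by omega) ω ω' hω
        have e2 := hwin n ω ω' hω
        simp only at e1
        rw [e1, e2]
      · rw [integral_const_mul]
        refine (mul_le_mul_of_nonneg_left ih (Real.exp_pos _).le).trans_eq ?_
        rw [← Real.exp_add]; congr 1; push_cast; ring
  -- Removing that factor costs `exp (|l| H)`, as did introducing it at time `0`; hence `2 * |l| *
  -- H`.
  have hfin : ∀ ω, Real.exp (l * ∑ i ∈ Finset.range n, g (win m Z i ω)) ≤
      Real.exp (|l| * H) * (Real.exp (l * ∑ i ∈ Finset.range n, g (win m Z i ω)) *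
      Real.exp (l * h (win m Z n ω))) := by
    intro ω
    have : -(|l| * H) ≤ l * h (win m Z n ω) :=
      (abs_le.1 (show |l * h (win m Z n ω)| ≤ |l| * H by
        rw [abs_mul]; exact mul_le_mul_of_nonneg_left (hh _) (abs_nonneg l))).1
    rw [← Real.exp_add, ← Real.exp_add]
    exact Real.exp_le_exp.2 (by linarith)
  refine (integral_mono (hZ.integrable (N := n + m) fun ω ω' hω => ?_)
    ((hZ.integrable (N := n + m) fun ω ω' hω => ?_).const_mul _) hfin).trans ?_
  · have e1 := hsum n n (by omega) ω ω' hω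
    simp only at e1
    rw [e1]
  · have e1 := hsum n n (by omega) ω ω' hω
    have e2 := hwin n ω ω' hω
    simp only at e1
    rw [e1, e2]
  · rw [integral_const_mul]
    refine (mul_le_mul_of_nonneg_left (hmain n) (Real.exp_pos _).le).trans_eq ?_
    rw [← Real.exp_add]; congr 1; ring

end Trajectories

/-! ### Exponential tail bounds for additive functionals -/

section Tail

variable {X Ω : Type*} [MeasurableSpace Ω] {P : Measure Ω} [IsProbabilityMeasure P] [Fintype X]
  {K : X → PMF X} {init : PMF X} {Z : ℕ → Ω → X} {m : ℕ}

/-- Concentration of the additive functional of a centered function along the windows of a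
Markov chain which, from time `k` on, stay in a closed irreducible set. -/
theorem IsMarkov.tail_bound (hZ : IsMarkov P init K Z) {C : Set (Fin (m + 1) → X)}
    (hC : ∀ w ∈ C, ∀ w', Pos (snake K m) w w' → w' ∈ C)
    (hirr : ∀ w ∈ C, ∀ w' ∈ C, Relation.TransGen (Pos (snake K m)) w w')
    {p : PMF (Fin (m + 1) → X)} (hp : IsStationaryDist (snake K m) C p)
    {W : ℕ → Ω → Fin (m + 1) → X} {k : ℕ}
    (hW : ∀ᵐ ω ∂P, ∀ i, k ≤ i → W i ω = win m Z i ω ∧ W i ω ∈ C)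
    {g : (Fin (m + 1) → X) → ℝ} (hg1 : ∀ w, |g w| ≤ 1) (hg : avg p g = 0) :
    ∃ A D : ℝ, 0 < A ∧ 0 < D ∧ ∀ (n : ℕ) (ε : ℝ), 0 ≤ ε → ε ≤ 1 →
      P.real {ω | n * ε ≤ ∑ i ∈ Finset.range n, g (W i ω)} ≤ A * Real.exp (-(n * ε ^ 2 / D)) := by
  obtain ⟨h, hh⟩ := exists_poisson hC hirr hp hg
  obtain ⟨H, hH, hhH⟩ : ∃ H : ℝ, 0 < H ∧ ∀ w, |h w| ≤ H :=
    ⟨1 + ∑ w, |h w|, by positivity, fun w => by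
      have := Finset.single_le_sum (f := fun w => |h w|) (fun _ _ => abs_nonneg _)
        (Finset.mem_univ w)
      linarith⟩
  set g' : (Fin (m + 1) → X) → ℝ := fun w => h w - avg (snake K m w) h with hg'
  have hg'H : ∀ w, |g' w| ≤ 2 * H := fun w =>
    (abs_sub _ _).trans (by linarith [hhH w, abs_avg_le (snake K m w) hhH])
  -- Before time `k` the Poisson equation is unavailable; each such term costs at most `1 + 2 * H`,
  -- from `g ≤ 1` and `g' ≥ -2 * H`.
  set B : ℝ := k * (1 + 2 * H) with hB
  have hcmp : ∀ᵐ ω ∂P, ∀ n : ℕ, ∑ i ∈ Finset.range n, g (W i ω) ≤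
      B + ∑ i ∈ Finset.range n, g' (win m Z i ω) := by
    filter_upwards [hW] with ω hω n
    have h1 : ∀ i ∈ Finset.range n, g (W i ω) ≤
        (if i < k then 1 + 2 * H else 0) + g' (win m Z i ω) := by
      intro i _
      split_ifs with hi
      · linarith [(abs_le.1 (hg1 (W i ω))).2, (abs_le.1 (hg'H (win m Z i ω))).1]
      · obtain ⟨e, hc⟩ := hω i (not_lt.1 hi)
        rw [← hh _ hc, e, zero_add]
    refine (Finset.sum_le_sum h1).trans ?_
    rw [Finset.sum_add_distrib, ← Finset.sum_filter, Finset.sum_const, nsmul_eq_mul, hB]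
    have : ((Finset.range n).filter (· < k)).card ≤ k := by
      refine (Finset.card_le_card (t := Finset.range k) fun i hi => ?_).trans_eq
        (Finset.card_range k)
      exact Finset.mem_range.2 (Finset.mem_filter.1 hi).2
    have : (((Finset.range n).filter (· < k)).card : ℝ) ≤ k := by exact_mod_cast this
    gcongr
  -- Chernoff's parameter `l = ε / (4 H²)` minimizes `-l n ε + 2 n l² H²`, with value `-n ε² / (8
  -- H²)`. The remainder `l (B + 2 H)` is bounded using `ε ≤ 1`.
  refine ⟨Real.exp ((B + 2 * H) / (4 * H ^ 2)), 8 * H ^ 2, Real.exp_pos _, by positivity,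
    fun n ε h0 h1 => ?_⟩
  have hl : 0 ≤ ε / (4 * H ^ 2) := by positivity
  have hS : Adapted Z (n + m) fun ω => ∑ i ∈ Finset.range n, g' (win m Z i ω) := fun ω ω' hω =>
    Finset.sum_congr rfl fun i hi => by
      congr 1; ext j; exact hω _ (by have := Finset.mem_range.1 hi; omega)
  have hint : Integrable (fun ω => Real.exp (ε / (4 * H ^ 2) *
      ∑ i ∈ Finset.range n, g' (win m Z i ω))) P :=
    hZ.integrable (N := n + m) fun ω ω' hω => by
      have := hS ω ω' hω
      simp only at this
      rw [this]
  have hch := ProbabilityTheory.measure_ge_le_exp_mul_mgf (μ := P)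
    (X := fun ω => ∑ i ∈ Finset.range n, g' (win m Z i ω)) (n * ε - B) hl hint
  have hmgf := hZ.integral_exp_le hH hhH (ε / (4 * H ^ 2)) n
  rw [abs_of_nonneg hl] at hmgf
  have hsub : P.real {ω | n * ε ≤ ∑ i ∈ Finset.range n, g (W i ω)} ≤
      P.real {ω | n * ε - B ≤ ∑ i ∈ Finset.range n, g' (win m Z i ω)} := by
    refine ENNReal.toReal_mono (measure_ne_top _ _) (measure_mono_ae ?_)
    filter_upwards [hcmp] with ω hω hmem
    have := hω n
    have hmem : n * ε ≤ ∑ i ∈ Finset.range n, g (W i ω) := hmem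
    change n * ε - B ≤ _
    linarith
  refine hsub.trans (hch.trans ((mul_le_mul_of_nonneg_left hmgf (Real.exp_pos _).le).trans ?_))
  rw [← Real.exp_add, ← Real.exp_add, Real.exp_le_exp]
  have hB0 : 0 ≤ B := by positivity
  have e : (B + 2 * H) / (4 * H ^ 2) + -(n * ε ^ 2 / (8 * H ^ 2)) -
      (-(ε / (4 * H ^ 2)) * (n * ε - B) + (2 * (ε / (4 * H ^ 2)) * H +
        n * (2 * (ε / (4 * H ^ 2)) ^ 2 * H ^ 2))) = (1 - ε) * ((B + 2 * H) / (4 * H ^ 2)) := by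
    field_simp; ring
  have : 0 ≤ (1 - ε) * ((B + 2 * H) / (4 * H ^ 2)) :=
    mul_nonneg (by linarith) (by positivity)
  linarith

end Tail

/-! ### Closedness and irreducibility of the window chain -/

section Snake

variable {X : Type*} {K : X → PMF X} {m : ℕ}

/-- The windows in `C` whose successive transitions have positive probability. -/
def windows (K : X → PMF X) (C : Set X) (m : ℕ) : Set (Fin (m + 1) → X) :=
  {w | (∀ i, w i ∈ C) ∧ ∀ i : Fin m, K (w i.castSucc) (w i.succ) ≠ 0}

theorem pos_snake_iff {w w' : Fin (m + 1) → X} : Pos (snake K m) w w' ↔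
    ∃ y, Pos K (w (Fin.last m)) y ∧ Fin.snoc (α := fun _ => X) (Fin.tail w) y = w' := by
  rw [Pos, ← PMF.mem_support_iff, snake, PMF.mem_support_map_iff]
  rfl

theorem windows_closed {C : Set X} (hC : ∀ x ∈ C, ∀ y, Pos K x y → y ∈ C) :
    ∀ w ∈ windows K C m, ∀ w', Pos (snake K m) w w' → w' ∈ windows K C m := by
  rintro w ⟨hw, hpos⟩ w' h
  obtain ⟨y, hy, rfl⟩ := pos_snake_iff.1 h
  refine ⟨fun i => ?_, fun i => ?_⟩
  · refine Fin.lastCases ?_ (fun j => ?_) i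
    · rw [Fin.snoc_last]; exact hC _ (hw _) _ hy
    · rw [Fin.snoc_castSucc]; exact hw _
  · rw [Fin.snoc_castSucc]
    rcases Fin.eq_castSucc_or_eq_last i.succ with ⟨j, hj⟩ | hj
    · rw [hj, Fin.snoc_castSucc, Fin.tail, Fin.tail, hj]
      exact hpos j
    · rw [hj, Fin.snoc_last, Fin.tail, hj]
      exact hy

theorem snake_transGen {w : Fin (m + 1) → X} {y : X}
    (h : Relation.TransGen (Pos K) (w (Fin.last m)) y) :
    ∃ w', w' (Fin.last m) = y ∧ Relation.TransGen (Pos (snake K m)) w w' := by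
  induction h with
  | single h => exact ⟨_, Fin.snoc_last _ _, .single (pos_snake_iff.2 ⟨_, h, rfl⟩)⟩
  | tail _ h ih =>
    obtain ⟨w', rfl, ih⟩ := ih
    exact ⟨_, Fin.snoc_last _ _, ih.tail (pos_snake_iff.2 ⟨_, h, rfl⟩)⟩

/-- Appending `w' 1, …, w' m` after the shared entry `w' 0` pushes out everything older. -/
theorem snake_reflTransGen {w w' : Fin (m + 1) → X}
    (hw' : ∀ i : Fin m, K (w' i.castSucc) (w' i.succ) ≠ 0) (h : w (Fin.last m) = w' 0) :
    Relation.ReflTransGen (Pos (snake K m)) w w' := by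
  let u : ℕ → X := fun t => if h : t < m + 1 then w' ⟨t, h⟩ else w' 0
  have hu : ∀ i : Fin (m + 1), u i = w' i := fun i => dif_pos i.2
  -- After `k` steps the last `k + 1` entries are `w' 0, …, w' k`.
  have key : ∀ k ≤ m, ∃ v, Relation.ReflTransGen (Pos (snake K m)) w v ∧
      ∀ i : Fin (m + 1), m ≤ i + k → v i = u (i + k - m) := by
    intro k hk
    induction k with
    | zero =>
      refine ⟨w, .refl, fun i hi => ?_⟩
      have : i = Fin.last m := Fin.ext (by have := i.2; simp only [Fin.val_last]; omega)
      rw [this, h, ← hu 0]; simp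
    | succ k ih =>
      obtain ⟨v, hv, hvu⟩ := ih (by omega)
      have hlast : v (Fin.last m) = u k := by
        rw [hvu _ (by simp)]; congr 1; simp
      have hstep : Pos K (v (Fin.last m)) (u (k + 1)) := by
        have := hw' ⟨k, by omega⟩
        rw [← hu, ← hu] at this
        rw [hlast]
        exact this
      refine ⟨_, hv.tail (pos_snake_iff.2 ⟨_, hstep, rfl⟩), fun i => ?_⟩
      refine Fin.lastCases (fun _ => ?_) (fun j hj => ?_) i
      · rw [Fin.snoc_last]; congr 1; simp
      · rw [Fin.snoc_castSucc, Fin.tail, hvu _ (by simp at hj ⊢; omega)]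
        congr 1; simp; omega
  obtain ⟨v, hv, hvu⟩ := key m le_rfl
  have : v = w' := by
    ext i
    rw [hvu i (by omega), Nat.add_sub_cancel, hu]
  rwa [← this]

/-- Irreducibility of `K` steers the newest entry to `w' 0`; then `w'` itself is fed in. -/
theorem windows_irreducible {C : Set X}
    (hirr : ∀ x ∈ C, ∀ y ∈ C, Relation.TransGen (Pos K) x y) :
    ∀ w ∈ windows K C m, ∀ w' ∈ windows K C m, Relation.TransGen (Pos (snake K m)) w w' := by
  rintro w ⟨hw, -⟩ w' ⟨hw', hpos⟩
  obtain ⟨v, hv, h⟩ := snake_transGen (hirr _ (hw (Fin.last m)) _ (hw' 0))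
  exact h.trans_left (snake_reflTransGen hpos hv)

end Snake

/-! ### From `n`-step probabilities to paths -/

section Reachability

variable {X : Type*} {K : X → PMF X} {init : PMF X}

theorem reflTransGen_of_iter {n : ℕ} {x y : X} (h : iter K n x y ≠ 0) :
    Relation.ReflTransGen (Pos K) x y := by
  induction n generalizing y with
  | zero =>
    rw [iter, ← PMF.mem_support_iff, PMF.mem_support_pure_iff] at h
    rw [h]
  | succ n ih =>
    rw [iter, ← PMF.mem_support_iff, PMF.mem_support_bind_iff] at h
    obtain ⟨z, hz, hzy⟩ := h
    exact (ih hz).tail hzy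

theorem transGen_of_iter {n : ℕ} (hn : 1 ≤ n) {x y : X} (h : iter K n x y ≠ 0) :
    Relation.TransGen (Pos K) x y := by
  obtain ⟨n, rfl⟩ := Nat.exists_eq_add_of_le' hn
  rw [iter, ← PMF.mem_support_iff, PMF.mem_support_bind_iff] at h
  obtain ⟨z, hz, hzy⟩ := h
  exact Relation.TransGen.tail' (reflTransGen_of_iter hz) hzy

theorem reachable_of_init {x : X} (h : init x ≠ 0) : x ∈ reachable init K := by
  refine ⟨0, ?_⟩
  rw [PMF.mem_support_bind_iff]
  exact ⟨x, h, by rw [iter, PMF.mem_support_pure_iff]⟩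

theorem reachable_closed {x y : X} (hx : x ∈ reachable init K) (h : Pos K x y) :
    y ∈ reachable init K := by
  obtain ⟨n, hn⟩ := hx
  rw [PMF.mem_support_bind_iff] at hn
  obtain ⟨a, ha, hax⟩ := hn
  refine ⟨n + 1, ?_⟩
  rw [PMF.mem_support_bind_iff]
  refine ⟨a, ha, ?_⟩
  rw [iter, PMF.mem_support_bind_iff]
  exact ⟨x, hax, h⟩

end Reachability

/-! ### The chain of triples of an MDP and its executions -/

namespace MDP

variable {S A : Type*} (M : MDP S A) (pol : S → PMF A) (s₀ : S)

theorem step_apply (s : S) (a : A) (s' : S) (r : M.rewards) :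
    M.step pol s (a, s', r) = pol s a * M.kernel s a (s', r) := by
  classical
  rw [step, PMF.bind_apply, tsum_eq_single a]
  · rw [PMF.map_apply, tsum_eq_single (s', r)]
    · simp
    · intro y hy
      simp [hy.symm]
  · intro b hb
    have : (M.kernel s b).map (fun y => (b, y)) (a, s', r) = 0 := by
      rw [PMF.apply_eq_zero_iff, PMF.mem_support_map_iff]
      rintro ⟨y, -, hy⟩
      exact hb (congrArg Prod.fst hy)
    rw [this, mul_zero]

variable {M pol s₀}

theorem pairStep_ne_zero {s : S} {y : A × S × M.rewards} (h : M.step pol s y ≠ 0) :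
    M.pairStep pol s (y.1, y.2.1) ≠ 0 := by
  rw [pairStep, ← PMF.mem_support_iff, PMF.mem_support_map_iff]
  exact ⟨y, h, rfl⟩

theorem pair_mem_of_augSpace {y : A × S × M.rewards} (hy : y ∈ M.augSpace pol s₀) :
    (y.1, y.2.1) ∈ M.pairSpace pol s₀ := by
  obtain ⟨x, hx, h⟩ := hy
  exact reachable_closed hx (pairStep_ne_zero h)

theorem augSpace_closed : ∀ y ∈ M.augSpace pol s₀, ∀ y', Pos (M.augKernel pol) y y' →
    y' ∈ M.augSpace pol s₀ :=
  fun y hy _ h => ⟨(y.1, y.2.1), pair_mem_of_augSpace hy, h⟩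

/-- Both kernels read only the current state, so a path of pairs lifts to triples by choosing a
possible reward at each step. -/
theorem augKernel_transGen {x x' : A × S} (h : Relation.TransGen (Pos (M.pairKernel pol)) x x')
    {y : A × S × M.rewards} (hy : y.2.1 = x.2) :
    ∃ y', y'.2.1 = x'.2 ∧ Relation.TransGen (Pos (M.augKernel pol)) y y' := by
  have lift : ∀ {u v : A × S} {y : A × S × M.rewards}, y.2.1 = u.2 →
      Pos (M.pairKernel pol) u v → ∃ y', y'.2.1 = v.2 ∧ Pos (M.augKernel pol) y y' := by
    intro u v y hy h
    rw [Pos, pairKernel, pairStep, ← PMF.mem_support_iff, PMF.mem_support_map_iff] at h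
    obtain ⟨y', hy', rfl⟩ := h
    refine ⟨y', rfl, ?_⟩
    rw [Pos, augKernel, hy]
    exact hy'
  induction h with
  | single h =>
    obtain ⟨y', h1, h2⟩ := lift hy h
    exact ⟨y', h1, .single h2⟩
  | tail _ h ih =>
    obtain ⟨y', h1, h2⟩ := ih
    obtain ⟨y'', h3, h4⟩ := lift h1 h
    exact ⟨y'', h3, h2.tail h4⟩

/-- The target `y'` has a predecessor pair in `pairSpace`. A lifted path reaches the state of that
pair, and one further step produces `y'` with its prescribed reward. -/
theorem augSpace_irreducible
    (hirr : IsIrreducible (M.pairKernel pol) (M.pairSpace pol s₀)) :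
    ∀ y ∈ M.augSpace pol s₀, ∀ y' ∈ M.augSpace pol s₀,
      Relation.TransGen (Pos (M.augKernel pol)) y y' := by
  rintro y hy y' ⟨x', hx', h⟩
  obtain ⟨n, hn, hxx⟩ := hirr _ (pair_mem_of_augSpace hy) _ hx'
  obtain ⟨y₁, h1, h2⟩ := augKernel_transGen (transGen_of_iter hn hxx) (y := y) rfl
  refine h2.tail ?_
  rw [Pos, augKernel, h1]
  exact h

variable {Ω : Type*} [MeasurableSpace Ω] {P : Measure Ω}
  {St : ℕ → Ω → S} {Ac : ℕ → Ω → A} {Re : ℕ → Ω → M.rewards}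

/-- The process `(A_t, S_t, R_t)` of an execution, with a given value at time `0`. -/
def triple (y₀ : A × S × M.rewards) (St : ℕ → Ω → S) (Ac : ℕ → Ω → A)
    (Re : ℕ → Ω → M.rewards) : ℕ → Ω → A × S × M.rewards
  | 0, _ => y₀
  | t + 1, ω => (Ac (t + 1) ω, St (t + 1) ω, Re (t + 1) ω)

/-- The action and reward at time `0` have no prescribed law, so the triple at time `0` is frozen at
`y₀`; only its state `s₀` affects the next step. -/
theorem IsExecution.isMarkov [IsProbabilityMeasure P] (h : M.IsExecution pol s₀ P St Ac Re)
    {y₀ : A × S × M.rewards} (hy₀ : y₀.2.1 = s₀) :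
    IsMarkov P (PMF.pure y₀) (M.augKernel pol) (triple y₀ St Ac Re) where
  measurable t x := by
    cases t with
    | zero => exact MeasurableSet.const (y₀ = x)
    | succ t =>
      have : {ω | triple y₀ St Ac Re (t + 1) ω = x} = {ω | Ac (t + 1) ω = x.1} ∩
          ({ω | St (t + 1) ω = x.2.1} ∩ {ω | Re (t + 1) ω = x.2.2}) := by
        ext ω; simp [triple, Prod.ext_iff]
      rw [this]
      exact (h.measurable_action _ _).inter
        ((h.measurable_state _ _).inter (h.measurable_reward _ _))
  law N z := by
    classical
    by_cases hz : z 0 = y₀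
    · have := h.law N (fun t => (z t).2.1) (fun t => (z t).1) (fun t => (z t).2.2)
        (by rw [hz, hy₀])
      rw [hz, PMF.pure_apply, if_pos rfl, one_mul]
      refine Eq.trans ?_ (this.trans ?_)
      · congr 1; ext ω
        simp only [Set.mem_ofPred_eq]
        constructor
        · intro hω t ht
          have := hω (t + 1) ht
          rw [← this]; exact ⟨rfl, rfl, rfl⟩
        · rintro hω (_ | t) ht
          · exact hz.symm
          · obtain ⟨h1, h2, h3⟩ := hω t ht
            exact Prod.ext h1 (Prod.ext h2 h3)
      · exact Finset.prod_congr rfl fun t _ => (step_apply M pol _ _ _ _).symm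
    · have : {ω | ∀ t ≤ N, triple y₀ St Ac Re t ω = z t} = ∅ := by
        ext ω
        simp only [Set.mem_ofPred_eq, Set.mem_empty_iff_false, iff_false]
        exact fun hω => hz (hω 0 (Nat.zero_le N)).symm
      rw [this, measure_empty, PMF.pure_apply, if_neg hz, zero_mul]

/-- The index `2` is needed because membership in `augSpace` asks for a predecessor pair in
`pairSpace`: the triple at time `1` follows `s₀`, which may never be visited again. -/
theorem IsExecution.ae_window_mem [Finite S] [Finite A] [IsProbabilityMeasure P]
    (h : M.IsExecution pol s₀ P St Ac Re)
    {y₀ : A × S × M.rewards} (hy₀ : y₀.2.1 = s₀) (m : ℕ) :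
    ∀ᵐ ω ∂P, ∀ i, 2 ≤ i → win m (triple y₀ St Ac Re) i ω ∈ M.snakeSpace pol s₀ m := by
  classical
  cases nonempty_fintype S
  cases nonempty_fintype A
  filter_upwards [(h.isMarkov hy₀).ae_pos] with ω ⟨_, hω⟩
  have h1 : ∀ t, ((triple y₀ St Ac Re (t + 1) ω).1, (triple y₀ St Ac Re (t + 1) ω).2.1) ∈
      M.pairSpace pol s₀ := by
    intro t
    induction t with
    | zero =>
      have := hω 0
      rw [Pos, augKernel, triple, hy₀] at this
      exact reachable_of_init (pairStep_ne_zero this)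
    | succ t ih => exact reachable_closed ih (pairStep_ne_zero (hω (t + 1)))
  have h2 : ∀ t, triple y₀ St Ac Re (t + 2) ω ∈ M.augSpace pol s₀ := fun t =>
    ⟨_, h1 t, hω (t + 1)⟩
  rintro i hi
  obtain ⟨i, rfl⟩ := Nat.exists_eq_add_of_le' hi
  refine ⟨fun j => ?_, fun j => ?_⟩
  · rw [win, Nat.add_right_comm]; exact h2 _
  · exact hω (i + 2 + j)

end MDP

/-! ### From exponential tails to consistency and rate -/

section Rate

variable {Ω : Type*} [MeasurableSpace Ω] {P : Measure Ω} [IsProbabilityMeasure P]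

/-- `f n` exceeds `ε` with probability exponentially small in `n * ε ^ 2`. -/
def HasTail (P : Measure Ω) (f : ℕ → Ω → ℝ) : Prop :=
  ∃ A D : ℝ, 0 < A ∧ 0 < D ∧ ∀ (n : ℕ) (ε : ℝ), 1 ≤ n → 0 < ε → ε ≤ 1 →
    P.real {ω | ε ≤ f n ω} ≤ A * Real.exp (-(n * ε ^ 2 / D))

theorem HasTail.hasStochasticRate {f : ℕ → Ω → ℝ} (hf0 : ∀ n ω, 0 ≤ f n ω)
    (hf1 : ∀ n ω, f n ω ≤ 1) (h : HasTail P f) : HasStochasticRate P f := by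
  obtain ⟨A, D, hA, hD, hAD⟩ := h
  obtain ⟨k, hk⟩ := pow_unbounded_of_one_lt A (one_lt_two : (1 : ℝ) < 2)
  -- This constant turns the exponential into `(δ / 2) ^ (k + 1)`, and `A < 2 ^ k` then gives a tail
  -- of at most `δ`.
  refine ⟨(k + 1) * D, by positivity, fun n hn δ hδ0 hδ1 => ?_⟩
  have hn' : (0 : ℝ) < n := by exact_mod_cast hn
  have hlog : 0 < Real.log (2 / δ) := Real.log_pos (by rw [lt_div_iff₀ hδ0]; linarith)
  set ε := √((k + 1) * D / n * Real.log (2 / δ)) with hε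
  have hpos : 0 < (k + 1) * D / n * Real.log (2 / δ) := by positivity
  have hε0 : 0 < ε := Real.sqrt_pos.2 hpos
  -- The tail bound covers only `ε ≤ 1`; beyond that, `f ≤ 1` suffices.
  rcases lt_or_ge 1 ε with h1 | h1
  · have : {ω | |f n ω| ≤ ε} = Set.univ := by
      ext ω
      simp only [Set.mem_ofPred_eq, Set.mem_univ, iff_true, abs_of_nonneg (hf0 n ω)]
      linarith [hf1 n ω]
    rw [this, probReal_univ]; linarith
  · have hb := hAD n ε hn hε0 h1
    have hexp : n * ε ^ 2 / D = ((k + 1 : ℕ) : ℝ) * Real.log (2 / δ) := by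
      rw [hε, Real.sq_sqrt hpos.le]; push_cast; field_simp
    have he : Real.exp (-(n * ε ^ 2 / D)) = (δ / 2) ^ (k + 1) := by
      rw [hexp, Real.exp_neg, Real.exp_nat_mul, Real.exp_log (by positivity), ← inv_pow, inv_div]
    have hle : A * (δ / 2) ^ (k + 1) ≤ δ := by
      calc A * (δ / 2) ^ (k + 1) ≤ 2 ^ k * (δ / 2) ^ (k + 1) := by gcongr
        _ = (δ / 2) * δ ^ k := by rw [div_pow]; field_simp; ring
        _ ≤ (δ / 2) * 1 := by gcongr; exact pow_le_one₀ hδ0.le hδ1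
        _ ≤ δ := by linarith
    rw [he] at hb
    have hun : (Set.univ : Set Ω) ⊆ {ω | |f n ω| ≤ ε} ∪ {ω | ε ≤ f n ω} := by
      intro ω _
      rcases le_total (f n ω) ε with h | h
      · left; simpa only [Set.mem_ofPred_eq, abs_of_nonneg (hf0 n ω)] using h
      · right; exact h
    have := (measureReal_mono (μ := P) hun).trans (measureReal_union_le _ _)
    rw [probReal_univ] at this
    linarith

theorem HasTail.isConsistent {est : ℕ → Ω → ℝ} {θ : ℝ}
    (h : HasTail P fun n ω => |est n ω - θ|) : IsConsistent P est θ := by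
  obtain ⟨A, D, hA, hD, hAD⟩ := h
  rw [IsConsistent, tendstoInMeasure_iff_measureReal_dist]
  intro ε hε
  have hε' : 0 < min ε 1 := lt_min hε one_pos
  have hlim : Tendsto (fun n : ℕ => A * Real.exp (-(n * min ε 1 ^ 2 / D))) atTop (𝓝 0) := by
    rw [← mul_zero A]
    refine Tendsto.const_mul A (Real.tendsto_exp_neg_atTop_nhds_zero.comp ?_)
    simp only [mul_div_assoc]
    exact tendsto_natCast_atTop_atTop.atTop_mul_const (by positivity)
  refine squeeze_zero' (Eventually.of_forall fun _ => measureReal_nonneg) ?_ hlim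
  filter_upwards [eventually_ge_atTop 1] with n hn
  refine le_trans (measureReal_mono fun ω hω => ?_) (hAD n _ hn hε' (min_le_right _ _))
  exact (min_le_left ε 1).trans (show ε ≤ |est n ω - θ| from hω)

end Rate

/-! ### Concentration of ratios of visit counts -/

section Ratio

variable {Ω T : Type*} [MeasurableSpace Ω] {P : Measure Ω} [IsProbabilityMeasure P] [Fintype T]

open Classical in
/-- The number of times before `n` at which `W` lies in `E`. -/
noncomputable def visits (W : ℕ → Ω → T) (E : Set T) (n : ℕ) (ω : Ω) : ℝ :=
  ∑ i ∈ Finset.range n, if W i ω ∈ E then 1 else 0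

omit [MeasurableSpace Ω] [Fintype T] in
theorem visits_nonneg (W : ℕ → Ω → T) (E : Set T) (n : ℕ) (ω : Ω) : 0 ≤ visits W E n ω :=
  Finset.sum_nonneg fun i _ => by split_ifs <;> norm_num

omit [MeasurableSpace Ω] [Fintype T] in
theorem visits_mono (W : ℕ → Ω → T) {E F : Set T} (h : E ⊆ F) (n : ℕ) (ω : Ω) :
    visits W E n ω ≤ visits W F n ω :=
  Finset.sum_le_sum fun i _ => by
    by_cases hE : W i ω ∈ E
    · rw [if_pos hE, if_pos (h hE)]
    · rw [if_neg hE]; split_ifs <;> norm_num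

theorem toReal_toOuterMeasure_mono (p : PMF T) {E F : Set T} (h : E ⊆ F) :
    (p.toOuterMeasure E).toReal ≤ (p.toOuterMeasure F).toReal := by
  classical
  rw [← avg_indicator, ← avg_indicator]
  refine avg_mono p fun x => ?_
  by_cases hE : x ∈ E
  · rw [if_pos hE, if_pos (h hE)]
  · rw [if_neg hE]; split_ifs <;> norm_num

theorem condProb_mem_Icc (p : PMF T) (E F : Set T) : condProb p E F ∈ Set.Icc (0 : ℝ) 1 :=
  ⟨div_nonneg ENNReal.toReal_nonneg ENNReal.toReal_nonneg,
    div_le_one_of_le₀ (toReal_toOuterMeasure_mono p Set.inter_subset_right)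
      ENNReal.toReal_nonneg⟩

omit [MeasurableSpace Ω] in
theorem abs_ratio_sub_le_one (W : ℕ → Ω → T) (p : PMF T) (E F : Set T) (n : ℕ) (ω : Ω) :
    |visits W (E ∩ F) n ω / visits W F n ω - condProb p E F| ≤ 1 := by
  obtain ⟨h0, h1⟩ := condProb_mem_Icc p E F
  have h2 : 0 ≤ visits W (E ∩ F) n ω / visits W F n ω :=
    div_nonneg (visits_nonneg _ _ _ _) (visits_nonneg _ _ _ _)
  have h3 : visits W (E ∩ F) n ω / visits W F n ω ≤ 1 :=
    div_le_one_of_le₀ (visits_mono W Set.inter_subset_right n ω) (visits_nonneg _ _ _ _)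
  rw [abs_le]; constructor <;> linarith

/-- Concentration of centered additive functionals gives concentration of the conditional
frequencies. -/
theorem hasTail_ratio {W : ℕ → Ω → T} {p : PMF T}
    (htail : ∀ g : T → ℝ, (∀ w, |g w| ≤ 1) → avg p g = 0 →
      ∃ A D : ℝ, 0 < A ∧ 0 < D ∧ ∀ (n : ℕ) (ε : ℝ), 0 ≤ ε → ε ≤ 1 →
        P.real {ω | n * ε ≤ ∑ i ∈ Finset.range n, g (W i ω)} ≤ A * Real.exp (-(n * ε ^ 2 / D)))
    (E F : Set T) (hF : p.toOuterMeasure F ≠ 0) :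
    HasTail P fun n ω => |visits W (E ∩ F) n ω / visits W F n ω - condProb p E F| := by
  classical
  set θ := condProb p E F with hθ
  obtain ⟨hθ0, hθ1⟩ := condProb_mem_Icc p E F
  rw [← hθ] at hθ0 hθ1
  set q := (p.toOuterMeasure F).toReal with hq
  have hq1 : q ≤ 1 := by
    rw [hq, ← avg_indicator]
    refine le_trans ?_ (avg_const p 1).le
    exact avg_mono p fun x => by split_ifs <;> norm_num
  have hq0 : 0 < q := by
    have hle : p.toOuterMeasure F ≠ ⊤ := by
      rw [PMF.toOuterMeasure_apply_fintype]
      refine (ENNReal.sum_lt_top.2 fun x _ => ?_).ne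
      exact (Set.indicator_le_self F p x).trans_lt (p.apply_lt_top x)
    exact ENNReal.toReal_pos hF hle
  let ind : Set T → T → ℝ := fun E x => if x ∈ E then 1 else 0
  have hind : ∀ E, avg p (ind E) = (p.toOuterMeasure E).toReal := avg_indicator p
  have hvis : ∀ E n ω, ∑ i ∈ Finset.range n, ind E (W i ω) = visits W E n ω := fun _ _ _ => rfl
  let g : T → ℝ := fun w => ind (E ∩ F) w - ind F w * θ
  let g₂ : T → ℝ := fun w => q - ind F w
  have hg1 : ∀ w, |g w| ≤ 1 := by
    intro w
    simp only [g, ind, Set.mem_inter_iff]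
    rw [abs_le]
    by_cases h1 : w ∈ E <;> by_cases h2 : w ∈ F <;> simp only [h1, h2, and_true, and_false,
      if_true, if_false] <;> constructor <;> linarith
  have hg0 : avg p g = 0 := by
    simp only [g]
    rw [avg_sub, avg_mul_const, hind, hind, hθ, condProb, mul_div_cancel₀ _ hq0.ne', sub_self]
  have hg2 : ∀ w, |g₂ w| ≤ 1 := by
    intro w
    simp only [g₂, ind]
    rw [abs_le]
    split_ifs <;> constructor <;> linarith
  have hg20 : avg p g₂ = 0 := by
    simp only [g₂]
    rw [avg_sub, avg_const, hind, sub_self]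
  obtain ⟨A₁, D₁, hA₁, hD₁, ht₁⟩ := htail g hg1 hg0
  obtain ⟨A₂, D₂, hA₂, hD₂, ht₂⟩ := htail (fun w => -g w) (fun w => by rw [abs_neg]; exact hg1 w)
    (by rw [avg_neg, hg0, neg_zero])
  obtain ⟨A₃, D₃, hA₃, hD₃, ht₃⟩ := htail g₂ hg2 hg20
  -- The three tails are used at level `ε * (q / 2)`, whence the factor `4 / q ^ 2`.
  refine ⟨A₁ + A₂ + A₃, (D₁ + D₂ + D₃) * (4 / q ^ 2), by positivity, by positivity,
    fun n ε hn hε0 hε1 => ?_⟩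
  have hn' : (0 : ℝ) < n := by exact_mod_cast hn
  have hη0 : 0 ≤ ε * (q / 2) := by positivity
  have hη1 : ε * (q / 2) ≤ 1 := by nlinarith
  -- Outside the third event `F` is visited more than `n q / 2` times, as `ε ≤ 1`. Outside the first
  -- two, the numerator of the error is below `n ε q / 2`, so the error is below `ε`.
  have hincl : {ω | ε ≤ |visits W (E ∩ F) n ω / visits W F n ω - θ|} ⊆
      ({ω | n * (ε * (q / 2)) ≤ ∑ i ∈ Finset.range n, g (W i ω)} ∪
        {ω | n * (ε * (q / 2)) ≤ ∑ i ∈ Finset.range n, -g (W i ω)}) ∪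
        {ω | n * (ε * (q / 2)) ≤ ∑ i ∈ Finset.range n, g₂ (W i ω)} := by
    intro ω hω
    by_contra hcon
    simp only [Set.mem_union, Set.mem_ofPred_eq, not_or, not_le] at hcon
    obtain ⟨⟨h1, h2⟩, h3⟩ := hcon
    have e1 : ∑ i ∈ Finset.range n, g (W i ω) = visits W (E ∩ F) n ω - visits W F n ω * θ := by
      simp only [g, Finset.sum_sub_distrib, ← Finset.sum_mul, hvis]
    have e3 : ∑ i ∈ Finset.range n, g₂ (W i ω) = n * q - visits W F n ω := by
      simp only [g₂, Finset.sum_sub_distrib, hvis, Finset.sum_const, Finset.card_range,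
        nsmul_eq_mul]
    rw [Finset.sum_neg_distrib, e1] at h2
    rw [e1] at h1
    rw [e3] at h3
    have hnq : 0 < n * q := by positivity
    have hN : n * (q / 2) < visits W F n ω := by nlinarith
    have hN0 : 0 < visits W F n ω := lt_trans (by positivity) hN
    have habs : |visits W (E ∩ F) n ω - visits W F n ω * θ| < n * (ε * (q / 2)) :=
      abs_lt.2 ⟨by linarith, h1⟩
    have hω : ε ≤ |visits W (E ∩ F) n ω / visits W F n ω - θ| := hω
    have e : visits W (E ∩ F) n ω / visits W F n ω - θ =
        (visits W (E ∩ F) n ω - visits W F n ω * θ) / visits W F n ω := by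
      field_simp
    rw [e, abs_div, abs_of_pos hN0, le_div_iff₀ hN0] at hω
    nlinarith
  have hexp : ∀ A D : ℝ, 0 < A → 0 < D → D ≤ D₁ + D₂ + D₃ →
      A * Real.exp (-(n * (ε * (q / 2)) ^ 2 / D)) ≤
        A * Real.exp (-(n * ε ^ 2 / ((D₁ + D₂ + D₃) * (4 / q ^ 2)))) := by
    intro A D hA hD hle
    have : n * ε ^ 2 / ((D₁ + D₂ + D₃) * (4 / q ^ 2)) =
        n * (ε * (q / 2)) ^ 2 / (D₁ + D₂ + D₃) := by
      field_simp
      norm_num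
    rw [this]
    gcongr
  calc P.real {ω | ε ≤ |visits W (E ∩ F) n ω / visits W F n ω - θ|} ≤ _ := measureReal_mono hincl
    _ ≤ _ := measureReal_union_le _ _
    _ ≤ _ := add_le_add_left (measureReal_union_le _ _) _
    _ ≤ _ := add_le_add (add_le_add (ht₁ n _ hη0 hη1) (ht₂ n _ hη0 hη1)) (ht₃ n _ hη0 hη1)
    _ ≤ _ := add_le_add (add_le_add (hexp A₁ D₁ hA₁ hD₁ (by linarith))
        (hexp A₂ D₂ hA₂ hD₂ (by linarith))) (hexp A₃ D₃ hA₃ hD₃ (by linarith))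
    _ = _ := by ring

end Ratio

/-! ### Bucket frequencies as ratios of visit counts -/

section Freq

open Classical in
theorem freq_filter_map {Y : Type*} (p : ℕ → Prop) [DecidablePred p] (s : ℕ → Y) (x : Y) (n : ℕ) :
    freq (((List.range n).filter fun i => p i).map s) x =
      (∑ i ∈ Finset.range n, if s i = x ∧ p i then (1 : ℝ) else 0) /
        ∑ i ∈ Finset.range n, if p i then (1 : ℝ) else 0 := by
  have h1 : ((((List.range n).filter fun i => p i).map s).count x : ℝ) =
      ∑ i ∈ Finset.range n, if s i = x ∧ p i then (1 : ℝ) else 0 := by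
    induction n with
    | zero => simp
    | succ n ih =>
      rw [List.range_succ, List.filter_append, List.map_append, List.count_append,
        Finset.sum_range_succ, Nat.cast_add, ih]
      congr 1
      by_cases h : p n <;> by_cases h' : s n = x <;> simp [h, h']
  have h2 : ((((List.range n).filter fun i => p i).map s).length : ℝ) =
      ∑ i ∈ Finset.range n, if p i then (1 : ℝ) else 0 := by
    clear h1
    induction n with
    | zero => simp
    | succ n ih =>
      rw [List.range_succ, List.filter_append, List.map_append, List.length_append,
        Finset.sum_range_succ, Nat.cast_add, ih]
      congr 1
      by_cases h : p n <;> simp [h]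
  rw [freq, h1, h2]

theorem freq_eq_visits {Ω T Y : Type*} {W : ℕ → Ω → T} {E F : Set T} {ω : Ω} {p : ℕ → Prop}
    {_ : DecidablePred p} {s : ℕ → Y} {x : Y} (n : ℕ) (hE : ∀ i, W i ω ∈ E ↔ s i = x)
    (hF : ∀ i, W i ω ∈ F ↔ p i) :
    freq (((List.range n).filter fun i => p i).map s) x =
      visits W (E ∩ F) n ω / visits W F n ω := by
  rw [freq_filter_map, visits, visits]
  have h : ∀ i, W i ω ∈ E ∩ F ↔ s i = x ∧ p i := fun i => and_congr (hE i) (hF i)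
  congr 1 <;> refine Finset.sum_congr rfl fun i _ => ?_
  · by_cases hc : s i = x ∧ p i
    · rw [if_pos hc, if_pos ((h i).2 hc)]
    · rw [if_neg hc, if_neg (mt (h i).1 hc)]
  · by_cases hc : p i
    · rw [if_pos hc, if_pos ((hF i).2 hc)]
    · rw [if_neg hc, if_neg (mt (hF i).1 hc)]

end Freq

/-! ### Windows of an execution -/

namespace MDP

variable {S A : Type*} {M : MDP S A} {pol : S → PMF A} {s₀ : S} {m : ℕ}

theorem condProb_joint (p : PMF (M.Window m)) (E F : Set (ℝ × M.Window m)) :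
    condProb (M.joint m p) E F = condProb p ((fun w => (M.windowReturn m w, w)) ⁻¹' E)
      ((fun w => (M.windowReturn m w, w)) ⁻¹' F) := by
  simp only [condProb, joint, PMF.toOuterMeasure_map_apply, Set.preimage_inter]

/-- The windows of an execution. -/
def execWindow {Ω : Type*} (m : ℕ) (St : ℕ → Ω → S) (Ac : ℕ → Ω → A) (Re : ℕ → Ω → M.rewards)
    (i : ℕ) (ω : Ω) : M.Window m :=
  fun j => (Ac (i + j) ω, St (i + j) ω, Re (i + j) ω)

/-- The entry of the window at time `i` itself is skipped: the return collects the rewards at times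
`i + 1, …, i + m`. -/
theorem windowReturn_execWindow {Ω : Type*} (St : ℕ → Ω → S) (Ac : ℕ → Ω → A)
    (Re : ℕ → Ω → M.rewards) (i : ℕ) (ω : Ω) :
    M.windowReturn m (execWindow m St Ac Re i ω) =
      laggedReturn m (fun t => (Re t ω : ℝ)) (i + 1) := by
  rw [windowReturn, laggedReturn, ← Fin.sum_univ_eq_sum_range
    (fun k => (Re (i + 1 + k) ω : ℝ))]
  refine Finset.sum_congr rfl fun k _ => ?_
  simp only [execWindow, Fin.val_succ]
  rw [show i + (k + 1) = i + 1 + k by omega]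

/-- For `m = 0` the literal `1 : Fin (m + 1)` would wrap around to `0`. -/
theorem execWindow_one {Ω : Type*} (hm : 1 ≤ m) (St : ℕ → Ω → S) (Ac : ℕ → Ω → A)
    (Re : ℕ → Ω → M.rewards) (i : ℕ) (ω : Ω) :
    (execWindow m St Ac Re i ω 1).1 = Ac (i + 1) ω := by
  have : ((1 : Fin (m + 1)) : ℕ) = 1 := by
    rw [Fin.val_one', Nat.mod_eq_of_lt (by omega)]
  simp only [execWindow, this]

theorem IsExecution.hasTail [Finite S] [Finite A]
    (hirr : IsIrreducible (M.pairKernel pol) (M.pairSpace pol s₀))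
    {Ω : Type*} [MeasurableSpace Ω] {P : Measure Ω} [IsProbabilityMeasure P]
    {St : ℕ → Ω → S} {Ac : ℕ → Ω → A} {Re : ℕ → Ω → M.rewards}
    (hexec : M.IsExecution pol s₀ P St Ac Re) {p : PMF (M.Window m)}
    (hp : IsStationaryDist (M.snakeKernel pol m) (M.snakeSpace pol s₀ m) p)
    (E F : Set (M.Window m)) (hF : p.toOuterMeasure F ≠ 0) :
    HasTail P fun n ω => |visits (execWindow m St Ac Re) (E ∩ F) n ω /
      visits (execWindow m St Ac Re) F n ω - condProb p E F| := by
  cases nonempty_fintype S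
  cases nonempty_fintype A
  obtain ⟨⟨a, s, r⟩, -⟩ := (M.step pol s₀).support_nonempty
  refine hasTail_ratio (fun g hg1 hg0 => ?_) E F hF
  refine (hexec.isMarkov (y₀ := (a, s₀, r)) rfl).tail_bound (C := M.snakeSpace pol s₀ m) (k := 2)
    (windows_closed augSpace_closed) (windows_irreducible (augSpace_irreducible hirr)) hp
    ?_ hg1 hg0
  filter_upwards [hexec.ae_window_mem (y₀ := (a, s₀, r)) rfl m] with ω hω i hi
  -- The two processes differ only at time `0`, which these windows do not contain.
  have : execWindow m St Ac Re i ω = win m (triple (a, s₀, r) St Ac Re) i ω := by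
    obtain ⟨i, rfl⟩ := Nat.exists_eq_add_of_le' hi
    ext j : 1
    rw [execWindow, win, show i + 2 + (j : ℕ) = (i + 1 + j) + 1 by omega]
    rfl
  exact ⟨this, this ▸ hω i hi⟩

end MDP

end CNC

/-! ### The main theorem -/

theorem theorem2 {S A Ω : Type*} [Finite S] [Finite A] [MeasurableSpace Ω]
    (M : CNC.MDP S A) (pol : S → PMF A) (s₀ : S) (m : ℕ) (hm : 1 ≤ m)
    (hchain : M.IsIREAPR pol s₀)
    (P : Measure Ω) [IsProbabilityMeasure P]
    (St : ℕ → Ω → S) (Ac : ℕ → Ω → A) (Re : ℕ → Ω → M.rewards)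
    (hexec : M.IsExecution pol s₀ P St Ac Re) :
    (∃! ν' : PMF (M.Window m),
      CNC.IsStationaryDist (M.snakeKernel pol m) (M.snakeSpace pol s₀ m) ν') ∧
    ∀ ν' : PMF (M.Window m),
      CNC.IsStationaryDist (M.snakeKernel pol m) (M.snakeSpace pol s₀ m) ν' →
      (∀ (s : S) (z : ℝ) (a : A),
        (M.joint m ν').toOuterMeasure (M.returnEvent m z ∩ M.actionEvent m a) ≠ 0 →
        CNC.IsConsistent P
          (fun n ω => CNC.freq (CNC.stateBucket m (fun t => St t ω) (fun t => Ac t ω)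
            (fun t => (Re t ω : ℝ)) z a n) s)
          (CNC.condProb (M.joint m ν') (M.stateEvent m s)
            (M.returnEvent m z ∩ M.actionEvent m a)) ∧
        CNC.HasStochasticRate P
          (fun n ω => |CNC.freq (CNC.stateBucket m (fun t => St t ω) (fun t => Ac t ω)
            (fun t => (Re t ω : ℝ)) z a n) s -
            CNC.condProb (M.joint m ν') (M.stateEvent m s)
              (M.returnEvent m z ∩ M.actionEvent m a)|)) ∧
      (∀ (z : ℝ) (a : A),
        (M.joint m ν').toOuterMeasure (M.actionEvent m a) ≠ 0 →
        CNC.IsConsistent P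
          (fun n ω => CNC.freq (CNC.returnBucket m (fun t => Ac t ω)
            (fun t => (Re t ω : ℝ)) a n) z)
          (CNC.condProb (M.joint m ν') (M.returnEvent m z) (M.actionEvent m a)) ∧
        CNC.HasStochasticRate P
          (fun n ω => |CNC.freq (CNC.returnBucket m (fun t => Ac t ω)
            (fun t => (Re t ω : ℝ)) a n) z -
            CNC.condProb (M.joint m ν') (M.returnEvent m z) (M.actionEvent m a)|)) := by
  cases nonempty_fintype S
  cases nonempty_fintype A
  -- By definition `snakeKernel` and `snakeSpace` are `snake` and `windows` of the chain of triples.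
  have hclosed : ∀ w ∈ M.snakeSpace pol s₀ m, ∀ w', CNC.Pos (M.snakeKernel pol m) w w' →
      w' ∈ M.snakeSpace pol s₀ m := CNC.windows_closed CNC.MDP.augSpace_closed
  have hirr : ∀ w ∈ M.snakeSpace pol s₀ m, ∀ w' ∈ M.snakeSpace pol s₀ m,
      Relation.TransGen (CNC.Pos (M.snakeKernel pol m)) w w' :=
    CNC.windows_irreducible (CNC.MDP.augSpace_irreducible hchain.irreducible)
  refine ⟨?_, fun ν' hν' => ⟨fun s z a hpos => ?_, fun z a hpos => ?_⟩⟩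
  -- An almost sure property holds somewhere, so the execution itself supplies a window.
  · have hne : (M.snakeSpace pol s₀ m).Nonempty := by
      obtain ⟨⟨a, s, r⟩, -⟩ := (M.step pol s₀).support_nonempty
      obtain ⟨ω, hω⟩ := (hexec.ae_window_mem (y₀ := (a, s₀, r)) rfl m).exists
      exact ⟨_, hω 2 le_rfl⟩
    obtain ⟨p, hp⟩ := CNC.exists_stationary hclosed hne
    exact ⟨p, hp, fun q hq => CNC.stationary_unique hclosed hirr hq hp⟩
  · rw [CNC.MDP.joint, PMF.toOuterMeasure_map_apply] at hpos
    have htail := hexec.hasTail hchain.irreducible hν'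
      ((fun w => (M.windowReturn m w, w)) ⁻¹' M.stateEvent m s) _ hpos
    rw [← CNC.MDP.condProb_joint] at htail
    have hest : ∀ n ω, CNC.freq (CNC.stateBucket m (fun t => St t ω) (fun t => Ac t ω)
        (fun t => (Re t ω : ℝ)) z a n) s =
        CNC.visits (CNC.MDP.execWindow m St Ac Re)
          ((fun w => (M.windowReturn m w, w)) ⁻¹' M.stateEvent m s ∩
            (fun w => (M.windowReturn m w, w)) ⁻¹' (M.returnEvent m z ∩ M.actionEvent m a)) n ω /
        CNC.visits (CNC.MDP.execWindow m St Ac Re)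
          ((fun w => (M.windowReturn m w, w)) ⁻¹' (M.returnEvent m z ∩ M.actionEvent m a)) n ω := by
      intro n ω
      refine CNC.freq_eq_visits n (fun i => Iff.rfl) fun i => and_congr ?_ ?_
      · exact (CNC.MDP.windowReturn_execWindow St Ac Re i ω).congr_left
      · exact (CNC.MDP.execWindow_one hm St Ac Re i ω).congr_left
    simp only [hest]
    refine ⟨CNC.HasTail.isConsistent ?_, CNC.HasTail.hasStochasticRate (fun _ _ => abs_nonneg _)
      (fun n ω => ?_) ?_⟩
    · exact htail
    · rw [CNC.MDP.condProb_joint]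
      exact CNC.abs_ratio_sub_le_one _ _ _ _ _ _
    · exact htail
  · rw [CNC.MDP.joint, PMF.toOuterMeasure_map_apply] at hpos
    have htail := hexec.hasTail hchain.irreducible hν'
      ((fun w => (M.windowReturn m w, w)) ⁻¹' M.returnEvent m z) _ hpos
    rw [← CNC.MDP.condProb_joint] at htail
    have hest : ∀ n ω, CNC.freq (CNC.returnBucket m (fun t => Ac t ω)
        (fun t => (Re t ω : ℝ)) a n) z =
        CNC.visits (CNC.MDP.execWindow m St Ac Re)
          ((fun w => (M.windowReturn m w, w)) ⁻¹' M.returnEvent m z ∩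
            (fun w => (M.windowReturn m w, w)) ⁻¹' M.actionEvent m a) n ω /
        CNC.visits (CNC.MDP.execWindow m St Ac Re)
          ((fun w => (M.windowReturn m w, w)) ⁻¹' M.actionEvent m a) n ω := by
      intro n ω
      refine CNC.freq_eq_visits n (fun i => ?_) fun i => ?_
      · exact (CNC.MDP.windowReturn_execWindow St Ac Re i ω).congr_left
      · exact (CNC.MDP.execWindow_one hm St Ac Re i ω).congr_left
    simp only [hest]
    refine ⟨CNC.HasTail.isConsistent ?_, CNC.HasTail.hasStochasticRate (fun _ _ => abs_nonneg _)
      (fun n ω => ?_) ?_⟩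
    · exact htail
    · rw [CNC.MDP.condProb_joint]
      exact CNC.abs_ratio_sub_le_one _ _ _ _ _ _
    · exact htail
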